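/- All graphs are finite, simple and undirected. For a graph $G$ and $D \subseteq V(G)$ let $N[D]$ be the closed neighbourhood of $D$. The set $D$ is a $1$-isolating set of $G$ if $G - N[D]$ has maximum degree at most $1$ (this includes the case that $G - N[D]$ has no vertices), and $\iota_1(G)$ is the smallest cardinality of a $1$-isolating set of $G$. Write $P_n$ and $C_n$ for the path and the cycle with $n$ vertices; "without $6$-cycles" means without a (not necessarily induced) subgraph isomorphic to $C_6$. **Theorem 1.6.** Let $G$ be a connected graph of order $n$ without $6$-cycles that is not isomorphic to any of $P_3, C_3, C_7, C_{11}$. Then $\iota_1(G) \le \frac{n}{4}$. The bound is sharp. Let $F$ be any connected graph without $6$-cycles, with vertices $v_1, \dots, v_t$ ($t \ge 1$). For each $i$ let $H_i$ be a graph isomorphic to a member of $\{P_3, C_3, C_7, C_{11}\}$ and let $a_i$ be any vertex of $H_i$. Let $G_t$ be the graph obtained from the vertex-disjoint union of $F, H_1, \dots, H_t$ by adding the edges $v_i a_i$, $1 \le i \le t$. Then $G_t$ is connected, has no $6$-cycles, is not isomorphic to any of $P_3, C_3, C_7, C_{11}$, and $\iota_1(G_t) = \frac{1}{4}|V(G_t)|$.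 -/

import Mathlib

namespace IsolationPaper

/-- The closed neighbourhood `N[D]` of a set `D` of vertices of `G`. -/
def closedNbhd {V : Type*} (G : SimpleGraph V) (D : Finset V) : Set V :=
  {w | ∃ v ∈ D, w = v ∨ G.Adj v w}

open Classical in
/-- `D` is a `k`-isolating set of `G`: the graph `G - N[D]`, i.e. the subgraph of `G` induced by
the complement of `N[D]`, has maximum degree at most `k` (the maximum degree of the graph without
vertices being `0`). -/
def IsIsolating {V : Type*} [Fintype V] (G : SimpleGraph V) (k : ℕ) (D : Finset V) : Prop :=
  (G.induce (closedNbhd G D)ᶜ).maxDegree ≤ k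

/-- The `k`-isolation number `ι_k(G)`: the smallest cardinality of a `k`-isolating set of `G`. -/
noncomputable def isolationNumber {V : Type*} [Fintype V] (k : ℕ) (G : SimpleGraph V) : ℕ :=
  sInf {m | ∃ D : Finset V, IsIsolating G k D ∧ D.card = m}

/-- The minimum in the definition of the `k`-isolation number is attained. -/
theorem exists_isIsolating_card_eq {V : Type*} [Fintype V] (k : ℕ) (G : SimpleGraph V) :
    ∃ D : Finset V, IsIsolating G k D ∧ D.card = isolationNumber k G := by
  classical
  refine Nat.sInf_mem (s := {m | ∃ D : Finset V, IsIsolating G k D ∧ D.card = m})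
    ⟨_, Finset.univ, ?_, rfl⟩
  unfold IsIsolating
  apply SimpleGraph.maxDegree_le_of_forall_degree_le
  rintro ⟨v, hv⟩
  exact absurd ⟨v, Finset.mem_univ v, Or.inl rfl⟩ hv

/-- `G` is, up to isomorphism, one of `P_3`, `C_3`, `C_7`, `C_11`. -/
def IsSGraph {V : Type*} (G : SimpleGraph V) : Prop :=
  Nonempty (G ≃g SimpleGraph.pathGraph 3) ∨ Nonempty (G ≃g SimpleGraph.cycleGraph 3) ∨
    Nonempty (G ≃g SimpleGraph.cycleGraph 7) ∨ Nonempty (G ≃g SimpleGraph.cycleGraph 11)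

/-- The graph obtained from the vertex-disjoint union of `F` and of graphs `H w`, one for every
vertex `w` of `F`, by joining each vertex `w` of `F` to the vertex `a w` of `H w`. -/
def attach {W : Type*} {U : W → Type*} (F : SimpleGraph W) (H : ∀ w, SimpleGraph (U w))
    (a : ∀ w, U w) : SimpleGraph (W ⊕ Σ w, U w) where
  Adj
    | .inl v, .inl w => F.Adj v w
    | .inl v, .inr p => p = ⟨v, a v⟩
    | .inr p, .inl v => p = ⟨v, a v⟩
    | .inr p, .inr q => ∃ (w : W) (x y : U w), p = ⟨w, x⟩ ∧ q = ⟨w, y⟩ ∧ (H w).Adj x y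
  symm := ⟨by
    rintro (v | p) (w | q) h
    · exact SimpleGraph.Adj.symm h
    · exact h
    · exact h
    · obtain ⟨w, x, y, hp, hq, hxy⟩ := h
      exact ⟨w, y, x, hq, hp, hxy.symm⟩⟩
  loopless := ⟨by
    rintro (v | p) h
    · exact F.irrefl h
    · obtain ⟨w, x, y, rfl, hq, hxy⟩ := h
      obtain rfl : x = y := by simpa using hq
      exact (H w).irrefl hxy⟩

end IsolationPaper

namespace IsolationPaper

section
open Classical

set_option linter.unusedSectionVars false

variable {V : Type*} [Fintype V] {G : SimpleGraph V}

/-- `u` lies in the closed neighbourhood of `D`. -/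
def Dom (G : SimpleGraph V) (D : Finset V) (u : V) : Prop := ∃ d ∈ D, u = d ∨ G.Adj d u

/-- No path with three vertices avoids the closed neighbourhood of `D` inside `A`. -/
def Iso (G : SimpleGraph V) (A D : Finset V) : Prop :=
  ∀ a b c, a ∈ A → b ∈ A → c ∈ A → ¬ Dom G D a → ¬ Dom G D b → ¬ Dom G D c →
    G.Adj a b → G.Adj b c → a = c

/-- The set `A` can be isolated at a cost of at most `m` quarters. -/
def Quarter (G : SimpleGraph V) (A : Finset V) (m : ℕ) : Prop :=
  ∃ D : Finset V, 4 * D.card ≤ m ∧ Iso G A D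

/-- The neighbours of `v`. -/
noncomputable def nb (G : SimpleGraph V) (v : V) : Finset V := Finset.univ.filter (G.Adj v)

/-- The vertices outside the closed neighbourhood of `v`. -/
noncomputable def far (G : SimpleGraph V) (v : V) : Finset V :=
  Finset.univ.filter fun u => u ≠ v ∧ ¬ G.Adj v u

/-- `C` induces a connected subgraph. -/
def Conn (G : SimpleGraph V) (C : Finset V) : Prop :=
  C.Nonempty ∧ ∀ T ⊆ C, T.Nonempty → (∀ u ∈ T, ∀ w ∈ C, G.Adj u w → w ∈ T) → T = C

/-- `C` is the vertex set of a component of the subgraph induced by `B`. -/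
def IsComp (G : SimpleGraph V) (B C : Finset V) : Prop :=
  C ⊆ B ∧ Conn G C ∧ ∀ u ∈ C, ∀ w ∈ B, G.Adj u w → w ∈ C

/-- `C` induces a copy of `P_3`, `C_3`, `C_7` or `C_11`. -/
def IsS (G : SimpleGraph V) (C : Finset V) : Prop := IsSGraph (G.induce (C : Set V))

/-- The components of the subgraph induced by `B` that are copies of `P_3`, `C_3`, `C_7`, `C_11`. -/
noncomputable def sComps (G : SimpleGraph V) (B : Finset V) : Finset (Finset V) :=
  Finset.univ.filter fun C => IsComp G B C ∧ IsS G C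

@[simp] theorem mem_nb {u v : V} : u ∈ nb G v ↔ G.Adj v u := by simp [nb]

@[simp] theorem mem_far {u v : V} : u ∈ far G v ↔ u ≠ v ∧ ¬ G.Adj v u := by simp [far]

@[simp] theorem mem_sComps {B C : Finset V} : C ∈ sComps G B ↔ IsComp G B C ∧ IsS G C := by
  simp [sComps]

theorem Dom.mono {D E : Finset V} (h : D ⊆ E) {u : V} (hu : Dom G D u) : Dom G E u := by
  obtain ⟨d, hd, h'⟩ := hu
  exact ⟨d, h hd, h'⟩

theorem Iso.mono {A B D E : Finset V} (h : Iso G B D) (hA : A ⊆ B) (hD : D ⊆ E) : Iso G A E :=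
  fun a b c ha hb hc ha' hb' hc' => h a b c (hA ha) (hA hb) (hA hc)
    (fun h => ha' (h.mono hD)) (fun h => hb' (h.mono hD)) (fun h => hc' (h.mono hD))

theorem iso_of_card_undominated {A D : Finset V} {p q : V}
    (h : ∀ u ∈ A, ¬ Dom G D u → u = p ∨ u = q) : Iso G A D := by
  intro a b c ha hb hc ha' hb' hc' hab hbc
  have := hab.ne
  have := hbc.ne
  rcases h a ha ha' with rfl | rfl <;> rcases h b hb hb' with rfl | rfl <;>
    rcases h c hc hc' with rfl | rfl <;> simp_all

theorem Conn.subset_of_closed {C T : Finset V} (h : Conn G C) (hT : ∃ u ∈ C, u ∈ T)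
    (hc : ∀ u ∈ C, u ∈ T → ∀ w ∈ C, G.Adj u w → w ∈ T) : C ⊆ T := by
  obtain ⟨u, hu, hu'⟩ := hT
  have := h.2 (C ∩ T) Finset.inter_subset_left ⟨u, by simp [hu, hu']⟩ (by
    intro u hu w hw huw
    rw [Finset.mem_inter] at hu ⊢
    exact ⟨hw, hc u hu.1 hu.2 w hw huw⟩)
  exact Finset.inter_eq_left.1 this

theorem exists_isComp {B : Finset V} {u : V} (hu : u ∈ B) : ∃ C, IsComp G B C ∧ u ∈ C := by
  let S : Finset (Finset V) := Finset.univ.filter fun C =>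
    C ⊆ B ∧ u ∈ C ∧ ∀ u ∈ C, ∀ w ∈ B, G.Adj u w → w ∈ C
  have hS : S.Nonempty := ⟨B, by simp [S, hu]; tauto⟩
  obtain ⟨C, hC, hmin⟩ := Finset.exists_min_image S Finset.card hS
  simp only [S, Finset.mem_filter, Finset.mem_univ, true_and] at hC hmin
  obtain ⟨hCB, huC, hcl⟩ := hC
  have key : ∀ T ⊆ C, u ∈ T → (∀ u ∈ T, ∀ w ∈ C, G.Adj u w → w ∈ T) → T = C := by
    intro T hT huT hTc
    refine Finset.eq_of_subset_of_card_le hT (hmin T ⟨hT.trans hCB, huT, ?_⟩)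
    intro a ha w hw haw
    exact hTc a ha w (hcl a (hT ha) w hw haw) haw
  refine ⟨C, ⟨hCB, ⟨⟨u, huC⟩, ?_⟩, hcl⟩, huC⟩
  intro T hT hne hTc
  by_cases huT : u ∈ T
  · exact key T hT huT hTc
  · exfalso
    have := key (C \ T) Finset.sdiff_subset (by simp [huC, huT]) (by
      intro a ha w hw haw
      rw [Finset.mem_sdiff] at ha ⊢
      exact ⟨hw, fun hwT => ha.2 (hTc w hwT a ha.1 haw.symm)⟩)
    obtain ⟨t, ht⟩ := hne
    have h1 := hT ht
    rw [← this] at h1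
    exact (Finset.mem_sdiff.1 h1).2 ht

theorem IsComp.subset {B C C' : Finset V} (h : IsComp G B C) (h' : IsComp G B C') {u : V}
    (hu : u ∈ C) (hu' : u ∈ C') : C ⊆ C' :=
  h.2.1.subset_of_closed ⟨u, hu, hu'⟩ fun _ _ ha' w hw haw => h'.2.2 _ ha' w (h.1 hw) haw

theorem IsComp.eq {B C C' : Finset V} (h : IsComp G B C) (h' : IsComp G B C') {u : V}
    (hu : u ∈ C) (hu' : u ∈ C') : C = C' :=
  (h.subset h' hu hu').antisymm (h'.subset h hu' hu)

/-- `f` enumerates the induced cycle `H` with `m` vertices. -/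
def IsCyc (G : SimpleGraph V) (H : Finset V) (m : ℕ) (f : ℕ → V) : Prop :=
  (∀ u, u ∈ H ↔ ∃ i < m, f i = u) ∧
    ∀ i j, i < j → j < m → f i ≠ f j ∧ (G.Adj (f i) (f j) ↔ j = i + 1 ∨ (i = 0 ∧ j + 1 = m))

/-- `H` is an induced path `a b c`. -/
def IsP3 (G : SimpleGraph V) (H : Finset V) (a b c : V) : Prop :=
  H = {a, b, c} ∧ a ≠ c ∧ G.Adj a b ∧ G.Adj b c ∧ ¬ G.Adj a c

/-- `H` is an induced cycle with `m` vertices, which can be traversed along any of its edges. -/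
def IsRing (G : SimpleGraph V) (H : Finset V) (m : ℕ) : Prop :=
  (∀ h ∈ H, ∀ g ∈ H, G.Adj h g → ∃ f, IsCyc G H m f ∧ f 0 = h ∧ f 1 = g) ∧
    (∀ h ∈ H, ∃ g ∈ H, G.Adj h g) ∧ H.Nonempty

theorem isRing_of_iso {H : Finset V} {n : ℕ}
    (hn : ∀ i j : Fin (n + 2), i < j → ((i - j = 1 ∨ j - i = 1) ↔
      (j.val = i.val + 1 ∨ (i.val = 0 ∧ j.val + 1 = n + 2))))
    (e : G.induce (H : Set V) ≃g SimpleGraph.cycleGraph (n + 2)) : IsRing G H (n + 2) := by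
  have hadj : ∀ a b : Fin (n + 2), G.Adj (e.symm a).1 (e.symm b).1 ↔ (a - b = 1 ∨ b - a = 1) := by
    intro a b
    rw [← SimpleGraph.cycleGraph_adj, ← e.symm.map_rel_iff]
    rfl
  refine ⟨?_, ?_, ⟨(e.symm 0).1, (e.symm 0).2⟩⟩
  · intro h hh g hg hgh
    obtain ⟨a, ha⟩ := e.symm.surjective ⟨h, hh⟩
    obtain ⟨b, hb⟩ := e.symm.surjective ⟨g, hg⟩
    have ha' : h = (e.symm a).1 := by rw [ha]
    have hb' : g = (e.symm b).1 := by rw [hb]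
    have hab := hgh
    rw [ha', hb', hadj] at hab
    obtain ⟨σ, hσ, h0, h1, hd⟩ : ∃ σ : Fin (n + 2) → Fin (n + 2), Function.Bijective σ ∧ σ 0 = a ∧
        σ 1 = b ∧ ∀ i j, ((σ i - σ j = 1 ∨ σ j - σ i = 1) ↔ (i - j = 1 ∨ j - i = 1)) := by
      rcases hab with h | h
      · refine ⟨fun i => a - i, (Equiv.subLeft a).bijective, by simp, ?_, ?_⟩
        · simp [← h]
        · intro i j
          simp [sub_sub_sub_cancel_left, or_comm]
      · refine ⟨fun i => a + i, (Equiv.addLeft a).bijective, by simp, ?_, ?_⟩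
        · simp [← h]
        · intro i j
          simp
    refine ⟨fun i => (e.symm (σ (Fin.ofNat (n + 2) i))).1, ⟨?_, ?_⟩, ?_, ?_⟩
    · intro u
      constructor
      · intro hu
        obtain ⟨c, hc⟩ := e.symm.surjective ⟨u, hu⟩
        obtain ⟨i, rfl⟩ := hσ.2 c
        refine ⟨i.1, i.2, ?_⟩
        have : Fin.ofNat (n + 2) i.1 = i := by ext; simp
        simp only [this, hc]
      · rintro ⟨i, -, rfl⟩
        exact (e.symm _).2
    · intro i j hij hj
      have hi : Fin.ofNat (n + 2) i = ⟨i, hij.trans hj⟩ := by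
        ext; simp [Nat.mod_eq_of_lt (hij.trans hj)]
      have hj' : Fin.ofNat (n + 2) j = ⟨j, hj⟩ := by ext; simp [Nat.mod_eq_of_lt hj]
      constructor
      · intro h
        have := hσ.1 (e.symm.injective (Subtype.ext h))
        rw [hi, hj', Fin.mk.injEq] at this
        omega
      · rw [hadj, hd, hi, hj']
        exact hn _ _ (by simpa using hij)
    · simp only [ha']; congr 2
    · simp only [hb']; congr 2
  · intro h hh
    obtain ⟨a, ha⟩ := e.symm.surjective ⟨h, hh⟩
    refine ⟨(e.symm (a + 1)).1, (e.symm (a + 1)).2, ?_⟩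
    have ha' : h = (e.symm a).1 := by rw [ha]
    rw [ha', hadj]
    simp

theorem IsS.cases {H : Finset V} (h : IsS G H) :
    (∃ a b c, IsP3 G H a b c) ∨ ∃ m, (m = 3 ∨ m = 7 ∨ m = 11) ∧ IsRing G H m := by
  rcases h with ⟨⟨e⟩⟩ | ⟨⟨e⟩⟩ | ⟨⟨e⟩⟩ | ⟨⟨e⟩⟩
  · left
    have hadj : ∀ a b : Fin 3, G.Adj (e.symm a).1 (e.symm b).1 ↔
        (SimpleGraph.pathGraph 3).Adj a b := by
      intro a b
      rw [← e.symm.map_rel_iff]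
      rfl
    refine ⟨(e.symm 0).1, (e.symm 1).1, (e.symm 2).1, ?_, ?_, ?_, ?_, ?_⟩
    · ext u
      simp only [Finset.mem_insert, Finset.mem_singleton]
      constructor
      · intro hu
        obtain ⟨c, hc⟩ := e.symm.surjective ⟨u, hu⟩
        have hc' : u = (e.symm c).1 := by rw [hc]
        subst hc'
        fin_cases c <;> simp
      · rintro (rfl | rfl | rfl)
        · exact (e.symm 0).2
        · exact (e.symm 1).2
        · exact (e.symm 2).2
    · intro h
      have := e.symm.injective (Subtype.ext h)
      simp at this
    · rw [hadj, SimpleGraph.pathGraph_adj]; simp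
    · rw [hadj, SimpleGraph.pathGraph_adj]; simp
    · rw [hadj, SimpleGraph.pathGraph_adj]; simp
  · exact Or.inr ⟨3, by simp, isRing_of_iso (by decide) e⟩
  · exact Or.inr ⟨7, by simp, isRing_of_iso (by decide) e⟩
  · exact Or.inr ⟨11, by simp, isRing_of_iso (by decide) e⟩

theorem IsRing.exists_isCyc {H : Finset V} {m : ℕ} (h : IsRing G H m) {u : V} (hu : u ∈ H) :
    ∃ f, IsCyc G H m f ∧ f 0 = u := by
  obtain ⟨g, hg, hug⟩ := h.2.1 u hu
  obtain ⟨f, hf, h0, -⟩ := h.1 u hu g hg hug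
  exact ⟨f, hf, h0⟩

theorem IsCyc.card {H : Finset V} {m : ℕ} {f : ℕ → V} (h : IsCyc G H m f) : H.card = m := by
  have : H = (Finset.range m).image f := by
    ext u
    simp [h.1]
  rw [this, Finset.card_image_of_injOn, Finset.card_range]
  intro i hi j hj hij
  simp only [Finset.coe_range, Set.mem_Iio] at hi hj
  rcases lt_trichotomy i j with hlt | rfl | hlt
  · exact absurd hij (h.2 _ _ hlt hj).1
  · rfl
  · exact absurd hij.symm (h.2 _ _ hlt hi).1

theorem IsRing.card {H : Finset V} {m : ℕ} (h : IsRing G H m) : H.card = m := by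
  obtain ⟨u, hu⟩ := h.2.2
  obtain ⟨f, hf, -⟩ := h.exists_isCyc hu
  exact hf.card

theorem IsP3.card {H : Finset V} {a b c : V} (h : IsP3 G H a b c) : H.card = 3 := by
  obtain ⟨rfl, hac, hab, hbc, -⟩ := h
  rw [Finset.card_eq_three]
  exact ⟨a, b, c, hab.ne, hac, hbc.ne, rfl⟩

theorem IsS.card {H : Finset V} (h : IsS G H) : H.card = 3 ∨ H.card = 7 ∨ H.card = 11 := by
  rcases h.cases with ⟨a, b, c, h⟩ | ⟨m, hm, h⟩
  · exact Or.inl h.card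
  · rwa [h.card]

/-- In a cycle every vertex has exactly two neighbours. -/
theorem IsRing.nb_eq {H : Finset V} {m : ℕ} (h : IsRing G H m) (hm : 3 ≤ m) {u : V} (hu : u ∈ H) :
    ∃ p q, p ∈ H ∧ q ∈ H ∧ p ≠ q ∧ G.Adj u p ∧ G.Adj u q ∧
      ∀ w ∈ H, G.Adj u w → w = p ∨ w = q := by
  obtain ⟨f, hf, rfl⟩ := h.exists_isCyc hu
  refine ⟨f 1, f (m - 1), (hf.1 _).2 ⟨1, by omega, rfl⟩, (hf.1 _).2 ⟨m - 1, by omega, rfl⟩,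
    (hf.2 1 (m - 1) (by omega) (by omega)).1, ?_, ?_, ?_⟩
  · rw [(hf.2 0 1 (by omega) (by omega)).2]; simp
  · rw [(hf.2 0 (m - 1) (by omega) (by omega)).2]; right; omega
  · intro w hw huw
    obtain ⟨j, hj, rfl⟩ := (hf.1 w).1 hw
    rcases Nat.eq_zero_or_pos j with rfl | hj0
    · exact absurd huw (G.loopless.irrefl _)
    · rw [(hf.2 0 j hj0 hj).2] at huw
      rcases huw with h | h
      · left; rw [h]
      · right; congr; omega

/-- A copy of `P_3`, `C_3`, `C_7` or `C_11` has maximum degree at most two. -/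
theorem IsS.eq_or_eq {H : Finset V} (h : IsS G H) {u p q w : V} (hu : u ∈ H) (hp : p ∈ H)
    (hq : q ∈ H) (hw : w ∈ H) (hpq : p ≠ q) (hup : G.Adj u p) (huq : G.Adj u q)
    (huw : G.Adj u w) : w = p ∨ w = q := by
  rcases h.cases with ⟨a, b, c, rfl, hac, hab, hbc, hnac⟩ | ⟨m, hm, h⟩
  · have := hup.ne
    have := huq.ne
    have := huw.ne
    simp only [Finset.mem_insert, Finset.mem_singleton] at hu hp hq hw
    grind
  · obtain ⟨p', q', -, -, -, -, -, h'⟩ := h.nb_eq (by omega) hu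
    rcases h' p hp hup with rfl | rfl <;> rcases h' q hq huq with rfl | rfl <;>
      rcases h' w hw huw with rfl | rfl <;> simp_all

/-- A path with `L` vertices can be isolated by `(L + 2) / 5` vertices. -/
theorem exists_iso_path {f : ℕ → V} {L : ℕ}
    (hf : ∀ i j, i < j → j < L → (G.Adj (f i) (f j) ↔ j = i + 1)) :
    ∃ D : Finset V, D.card ≤ (L + 2) / 5 ∧ Iso G ((Finset.range L).image f) D := by
  have hdom : ∀ i < L, 2 ≤ i % 5 →
      Dom G ((Finset.range ((L + 2) / 5)).image fun j => f (min (5 * j + 3) (L - 1))) (f i) := by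
    intro i hi h2
    refine ⟨f (min (5 * (i / 5) + 3) (L - 1)), ?_, ?_⟩
    · exact Finset.mem_image_of_mem _ (Finset.mem_range.2 (by omega))
    · rcases lt_trichotomy i (min (5 * (i / 5) + 3) (L - 1)) with h | h | h
      · right
        rw [G.adj_comm, hf _ _ h (by omega)]
        omega
      · left
        rw [← h]
      · right
        rw [hf _ _ h hi]
        omega
  refine ⟨(Finset.range ((L + 2) / 5)).image fun j => f (min (5 * j + 3) (L - 1)),
    Finset.card_image_le.trans (Finset.card_range _).le, ?_⟩
  intro a b c ha hb hc ha' hb' hc' hab hbc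
  obtain ⟨i, hi, rfl⟩ := Finset.mem_image.1 ha
  obtain ⟨j, hj, rfl⟩ := Finset.mem_image.1 hb
  obtain ⟨k, hk, rfl⟩ := Finset.mem_image.1 hc
  rw [Finset.mem_range] at hi hj hk
  have h1 : ∀ i j, i < L → j < L → G.Adj (f i) (f j) → j = i + 1 ∨ i = j + 1 := by
    intro i j hi hj h
    rcases lt_trichotomy i j with h' | rfl | h'
    · exact Or.inl ((hf i j h' hj).1 h)
    · exact absurd h (G.loopless.irrefl _)
    · exact Or.inr ((hf j i h' hi).1 h.symm)
  have h2 : ¬ 2 ≤ i % 5 := fun h => ha' (hdom i hi h)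
  have h3 : ¬ 2 ≤ j % 5 := fun h => hb' (hdom j hj h)
  have h4 : ¬ 2 ≤ k % 5 := fun h => hc' (hdom k hk h)
  rcases h1 i j hi hj hab with h | h <;> rcases h1 j k hj hk hbc with h' | h'
  · omega
  · congr 1; omega
  · congr 1; omega
  · omega

/-- After the deletion of a vertex, a copy of `P_3`, `C_3`, `C_7` or `C_11` with `4 k - 1` vertices
can be isolated by `k - 1` vertices. -/
theorem IsS.quarter_erase {H : Finset V} (h : IsS G H) {u : V} (hu : u ∈ H) :
    Quarter G (H.erase u) (H.card - 3) := by
  rcases h.cases with ⟨a, b, c, h⟩ | ⟨m, hm, h⟩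
  · refine ⟨∅, by simp, ?_⟩
    obtain ⟨rfl, -⟩ := h
    obtain ⟨p, q, hpq⟩ : ∃ p q, ∀ w ∈ ({a, b, c} : Finset V).erase u, w = p ∨ w = q := by
      simp only [Finset.mem_insert, Finset.mem_singleton, Finset.mem_erase] at hu ⊢
      rcases hu with rfl | rfl | rfl
      · exact ⟨b, c, by tauto⟩
      · exact ⟨a, c, by tauto⟩
      · exact ⟨a, b, by tauto⟩
    exact iso_of_card_undominated fun w hw _ => hpq w hw
  · obtain ⟨f, hf, rfl⟩ := h.exists_isCyc hu
    obtain ⟨D, hD, hi⟩ := exists_iso_path (G := G) (f := fun i => f (i + 1)) (L := m - 1) (by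
      intro i j hij hj
      rw [(hf.2 (i + 1) (j + 1) (by omega) (by omega)).2]
      omega)
    refine ⟨D, ?_, hi.mono ?_ subset_rfl⟩
    · rw [h.card]
      omega
    · intro w hw
      rw [Finset.mem_erase, hf.1] at hw
      obtain ⟨hne, i, hi, rfl⟩ := hw
      have : i ≠ 0 := by rintro rfl; exact hne rfl
      refine Finset.mem_image.2 ⟨i - 1, Finset.mem_range.2 (by omega), ?_⟩
      congr 1; omega

theorem IsS.quarter {H : Finset V} (h : IsS G H) : Quarter G H (H.card + 1) := by
  obtain ⟨u, hu⟩ : H.Nonempty := by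
    rw [← Finset.card_pos]
    rcases h.card with h | h | h <;> omega
  obtain ⟨D, hD, hi⟩ := h.quarter_erase hu
  refine ⟨insert u D, ?_, ?_⟩
  · have := Finset.card_insert_le u D
    rcases h.card with h | h | h <;> omega
  · intro a b c ha hb hc ha' hb' hc'
    have hne : ∀ w, ¬ Dom G (insert u D) w → w ≠ u := by
      rintro w hw rfl
      exact hw ⟨w, by simp, Or.inl rfl⟩
    refine (hi.mono subset_rfl (Finset.subset_insert u D)) a b c ?_ ?_ ?_ ha' hb' hc' <;>
      simp [*]

/-- Copies of `P_3`, `C_3`, `C_7` or `C_11` one vertex of which is already dominated. -/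
theorem IsS.quarter_of_dom {H D : Finset V} (h : IsS G H) {u : V} (hu : u ∈ H) (hd : Dom G D u) :
    Quarter G (H.filter fun w => ¬ Dom G D w) (H.card - 3) := by
  obtain ⟨E, hE, hi⟩ := h.quarter_erase hu
  refine ⟨E, hE, hi.mono ?_ subset_rfl⟩
  intro w hw
  rw [Finset.mem_filter] at hw
  rw [Finset.mem_erase]
  exact ⟨fun h => hw.2 (h ▸ hd), hw.1⟩

/-- A set `B` can be isolated componentwise, starting from a set `D₀`. -/
theorem exists_iso_of_components {B D₀ : Finset V}
    (hQ : ∀ C, IsComp G B C → ¬ IsS G C → Quarter G C C.card) :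
    ∃ D, D₀ ⊆ D ∧ Iso G B D ∧
      4 * D.card + 4 * ((sComps G B).filter fun C => ∃ u ∈ C, Dom G D₀ u).card ≤
        4 * D₀.card + B.card + (sComps G B).card := by
  let K : Finset (Finset V) := Finset.univ.filter (IsComp G B)
  have hK : ∀ C, C ∈ K ↔ IsComp G B C := by simp [K]
  have hex : ∀ C, ∃ E : Finset V, C ∈ K →
      Iso G (C.filter fun w => ¬ Dom G D₀ w) E ∧
        4 * E.card + (if IsS G C ∧ ∃ u ∈ C, Dom G D₀ u then 4 else 0) ≤
          C.card + (if IsS G C then 1 else 0) := by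
    intro C
    by_cases hC : C ∈ K
    swap
    · exact ⟨∅, fun h => absurd h hC⟩
    by_cases hS : IsS G C
    · by_cases hd : ∃ u ∈ C, Dom G D₀ u
      · obtain ⟨u, hu, hu'⟩ := hd
        obtain ⟨E, hE, hi⟩ := hS.quarter_of_dom hu hu'
        refine ⟨E, fun _ => ⟨hi, ?_⟩⟩
        rw [if_pos ⟨hS, u, hu, hu'⟩, if_pos hS]
        rcases hS.card with h | h | h <;> omega
      · obtain ⟨E, hE, hi⟩ := hS.quarter
        refine ⟨E, fun _ => ⟨hi.mono (Finset.filter_subset _ _) subset_rfl, ?_⟩⟩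
        simpa [hS, hd] using hE
    · obtain ⟨E, hE, hi⟩ := hQ C ((hK C).1 hC) hS
      refine ⟨E, fun _ => ⟨hi.mono (Finset.filter_subset _ _) subset_rfl, ?_⟩⟩
      simpa [hS] using hE
  choose E hE using hex
  refine ⟨D₀ ∪ K.biUnion E, Finset.subset_union_left, ?_, ?_⟩
  · intro a b c ha hb hc ha' hb' hc' hab hbc
    obtain ⟨C, hC, haC⟩ := exists_isComp (G := G) ha
    have hbC := hC.2.2 a haC b hb hab
    have hcC := hC.2.2 b hbC c hc hbc
    have hCK := (hK C).2 hC
    have hsub : E C ⊆ D₀ ∪ K.biUnion E := fun x hx =>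
      Finset.mem_union_right _ (Finset.mem_biUnion.2 ⟨C, hCK, hx⟩)
    have hd : ∀ {w}, ¬ Dom G (D₀ ∪ K.biUnion E) w → ¬ Dom G D₀ w :=
      fun hw h => hw (h.mono Finset.subset_union_left)
    exact ((hE C hCK).1.mono subset_rfl hsub) a b c (Finset.mem_filter.2 ⟨haC, hd ha'⟩)
      (Finset.mem_filter.2 ⟨hbC, hd hb'⟩) (Finset.mem_filter.2 ⟨hcC, hd hc'⟩) ha' hb' hc' hab hbc
  · have h1 : (D₀ ∪ K.biUnion E).card ≤ D₀.card + ∑ C ∈ K, (E C).card :=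
      (Finset.card_union_le _ _).trans (Nat.add_le_add_left Finset.card_biUnion_le _)
    have h2 : ∑ C ∈ K, C.card ≤ B.card := by
      have hd : (K : Set (Finset V)).PairwiseDisjoint id := by
        intro C hC C' hC' hne
        refine Finset.disjoint_left.2 fun u hu hu' => hne ?_
        exact ((hK C).1 hC).eq ((hK C').1 hC') hu hu'
      have := Finset.card_biUnion hd
      simp only [id] at this
      rw [← this]
      refine Finset.card_le_card fun u hu => ?_
      obtain ⟨C, hC, hu⟩ := Finset.mem_biUnion.1 hu
      exact ((hK C).1 hC).1 hu
    have h3 := Finset.sum_le_sum fun C hC => (hE C hC).2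
    rw [Finset.sum_add_distrib, Finset.sum_add_distrib, ← Finset.mul_sum, ← Finset.sum_filter,
      ← Finset.sum_filter] at h3
    have h4 : K.filter (fun C => IsS G C) = sComps G B := by
      ext C; simp [hK]
    have h5 : K.filter (fun C => IsS G C ∧ ∃ u ∈ C, Dom G D₀ u) =
        (sComps G B).filter fun C => ∃ u ∈ C, Dom G D₀ u := by
      ext C; simp [hK, and_assoc]
    rw [h4, h5] at h3
    simp only [Finset.sum_const, smul_eq_mul] at h3
    omega

/-- The reduction step: remove `Y`, which is isolated by `D₀`. -/
theorem quarter_univ_of_remove {Y D₀ : Finset V}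
    (hIH : ∀ C : Finset V, C ≠ Finset.univ → Conn G C → ¬ IsS G C → Quarter G C C.card)
    (hne : Y.Nonempty) (hY : Iso G Y D₀)
    (hout : ∀ u ∈ Y, ¬ Dom G D₀ u → ∀ w, G.Adj u w → w ∈ Y)
    (hcount : 4 * D₀.card + (sComps G Yᶜ).card ≤
      Y.card + 4 * ((sComps G Yᶜ).filter fun C => ∃ u ∈ C, Dom G D₀ u).card) :
    Quarter G Finset.univ (Fintype.card V) := by
  obtain ⟨D, hD, hi, hc⟩ := exists_iso_of_components (G := G) (B := Yᶜ) (D₀ := D₀) (by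
    intro C hC hS
    refine hIH C ?_ hC.2.1 hS
    rintro rfl
    obtain ⟨y, hy⟩ := hne
    exact Finset.mem_compl.1 (hC.1 (Finset.mem_univ y)) hy)
  refine ⟨D, ?_, ?_⟩
  · have := Finset.card_add_card_compl Y
    omega
  · intro a b c ha hb hc ha' hb' hc' hab hbc
    have key : ∀ {u w}, ¬ Dom G D u → u ∈ Y → G.Adj u w → w ∈ Y :=
      fun hu hY' h => hout _ hY' (fun h' => hu (h'.mono hD)) _ h
    by_cases hbY : b ∈ Y
    · exact hY.mono subset_rfl hD a b c (key hb' hbY hab.symm) hbY (key hb' hbY hbc) ha' hb' hc'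
        hab hbc
    · refine hi a b c ?_ (by simpa using hbY) ?_ ha' hb' hc' hab hbc
      · exact Finset.mem_compl.2 fun h => hbY (key ha' h hab)
      · exact Finset.mem_compl.2 fun h => hbY (key hc' h hbc.symm)

end

section
open Classical

set_option linter.unusedSectionVars false

/-- If every `s ∈ S` has two `R`-neighbours in `N` and no `X ⊆ N` has many `R`-neighbours in
proportion to its size, then `N` and `S` are tiny. -/
theorem bipartite_structure {α β : Type*} {N : Finset α} {S : Finset β} {R : α → β → Prop}
    (h2 : ∀ s ∈ S, 2 ≤ (N.filter fun x => R x s).card) (hN : 3 ≤ N.card)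
    (hbad : ∀ X ⊆ N, N.card + 4 * (S.filter fun s => ∃ x ∈ X, R x s).card <
      4 * X.card + S.card + 3) :
    (∀ x ∈ N, ∀ s ∈ S, ∀ s' ∈ S, R x s → R x s' → s = s') ∧
      (N.card = 3 ∧ S.card = 1 ∨
        N.card = 4 ∧ S.card = 2 ∧ ∀ s ∈ S, (N.filter fun x => R x s).card = 2) := by
  let k : Finset α → ℕ := fun X => (S.filter fun s => ∃ x ∈ X, R x s).card
  obtain ⟨X, hX, hmax⟩ := Finset.exists_max_image
    (N.powerset.filter fun X => 2 * X.card ≤ k X) Finset.card ⟨∅, by simp⟩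
  simp only [Finset.mem_filter, Finset.mem_powerset, and_imp] at hX hmax
  obtain ⟨hXN, hXk⟩ := hX
  let T := S.filter fun s => ¬ ∃ x ∈ X, R x s
  have hT : k X + T.card = S.card := Finset.card_filter_add_card_filter_not _
  have hone : ∀ x ∈ N, x ∉ X → (T.filter fun s => R x s).card ≤ 1 := by
    intro x hx hxX
    by_contra! hc
    have h1 : k X + (T.filter fun s => R x s).card ≤ k (insert x X) := by
      rw [← Finset.card_union_of_disjoint]
      · refine Finset.card_le_card fun s hs => ?_
        simp only [T, Finset.mem_union, Finset.mem_filter, Finset.mem_insert] at hs ⊢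
        grind
      · refine Finset.disjoint_left.2 fun s hs hs' => ?_
        simp only [T, Finset.mem_filter] at hs hs'
        exact hs'.1.2 hs.2
    have h2 : (insert x X).card = X.card + 1 := Finset.card_insert_of_notMem hxX
    have := hmax (insert x X) (Finset.insert_subset hx hXN) (by omega)
    omega
  have hcount : ∑ s ∈ T, (N.filter fun x => R x s).card ≤ N.card - X.card := by
    have h := Finset.sum_card_bipartiteAbove_eq_sum_card_bipartiteBelow (s := N) (t := T) R
    simp only [Finset.bipartiteAbove, Finset.bipartiteBelow] at h
    rw [← h, ← Finset.card_sdiff_of_subset hXN, Finset.card_eq_sum_ones,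
      ← Finset.sum_subset (Finset.sdiff_subset : N \ X ⊆ N)]
    · refine Finset.sum_le_sum fun x hx => ?_
      rw [Finset.mem_sdiff] at hx
      exact hone x hx.1 hx.2
    · intro x hx hx'
      have hxX : x ∈ X := by simpa [hx] using hx'
      rw [Finset.card_eq_zero, Finset.filter_eq_empty_iff]
      intro s hs hR
      exact (Finset.mem_filter.1 hs).2 ⟨x, hxX, hR⟩
  have hlow : 2 * T.card ≤ ∑ s ∈ T, (N.filter fun x => R x s).card := by
    rw [mul_comm, ← smul_eq_mul]
    exact Finset.card_nsmul_le_sum _ _ _ fun s hs => h2 s (Finset.mem_filter.1 hs).1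
  have hb : N.card + 4 * k X < 4 * X.card + S.card + 3 := hbad X hXN
  have hXle := Finset.card_le_card hXN
  have hX0 : X = ∅ := by
    rw [← Finset.card_eq_zero]
    omega
  have hTS : T = S := by
    ext s
    simp [T, hX0]
  rw [hTS] at hcount hlow hone
  have hk : k X = 0 := by simp [k, hX0]
  rw [hX0, Finset.card_empty] at hb hcount
  rw [hX0] at hone hk
  rw [hk] at hb
  refine ⟨?_, ?_⟩
  · intro x hx s hs s' hs' h h'
    exact Finset.card_le_one.1 (hone x hx (by simp)) s (by simp [hs, h]) s' (by simp [hs', h'])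
  · have hcases : N.card = 3 ∧ S.card = 1 ∨ N.card = 4 ∧ S.card = 2 := by omega
    rcases hcases with h | ⟨h4, h2'⟩
    · exact Or.inl h
    · refine Or.inr ⟨h4, h2', ?_⟩
      obtain ⟨s, t, hst, rfl⟩ := Finset.card_eq_two.1 h2'
      rw [Finset.sum_pair hst] at hcount
      have hs := h2 s (by simp)
      have ht := h2 t (by simp)
      intro r hr
      simp only [Finset.mem_insert, Finset.mem_singleton] at hr
      rcases hr with rfl | rfl <;> omega

variable {V : Type*} [Fintype V] {G : SimpleGraph V}

/-- `G` has no cycle with six vertices. -/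
def NoC6 (G : SimpleGraph V) : Prop :=
  ∀ a b c d e f, G.Adj a b → G.Adj b c → G.Adj c d → G.Adj d e → G.Adj e f → G.Adj f a →
    a ≠ c → a ≠ d → a ≠ e → b ≠ d → b ≠ e → b ≠ f → c ≠ e → c ≠ f → d ≠ f → False

/-- `G` is a connected graph without `6`-cycles that violates the bound, and the bound holds for
the smaller connected graphs in `G`. -/
structure Minimal (G : SimpleGraph V) : Prop where
  ih : ∀ C : Finset V, C ≠ Finset.univ → Conn G C → ¬ IsS G C → Quarter G C C.card
  conn : Conn G Finset.univ
  noC6 : NoC6 G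
  not_quarter : ¬ Quarter G Finset.univ (Fintype.card V)

theorem IsS.nonempty {H : Finset V} (h : IsS G H) : H.Nonempty := by
  rw [← Finset.card_pos]
  rcases h.card with h | h | h <;> omega

theorem three_le_card_nb {u a b c : V} (ha : G.Adj u a) (hb : G.Adj u b) (hc : G.Adj u c)
    (hab : a ≠ b) (hac : a ≠ c) (hbc : b ≠ c) : 3 ≤ (nb G u).card := by
  have : ({a, b, c} : Finset V) ⊆ nb G u := by
    intro w hw
    simp only [Finset.mem_insert, Finset.mem_singleton] at hw
    rcases hw with rfl | rfl | rfl <;> simpa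
  have h3 : ({a, b, c} : Finset V).card = 3 := Finset.card_eq_three.2 ⟨a, b, c, hab, hac, hbc, rfl⟩
  rw [← h3]
  exact Finset.card_le_card this

theorem far_eq (v : V) : far G v = (insert v (nb G v))ᶜ := by
  ext u
  simp

theorem IsComp.mem_far {v u : V} {H : Finset V} (h : IsComp G (far G v) H) (hu : u ∈ H) :
    u ≠ v ∧ ¬ G.Adj v u := IsolationPaper.mem_far.1 (h.1 hu)

/-- The neighbours of a component of `G - N[v]` lie in the component or in `N(v)`. -/
theorem IsComp.mem_or_adj {v u w : V} {H : Finset V} (h : IsComp G (far G v) H) (hu : u ∈ H)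
    (huw : G.Adj u w) : w ∈ H ∨ G.Adj v w := by
  by_cases hw : G.Adj v w
  · exact Or.inr hw
  · refine Or.inl (h.2.2 u hu w (IsolationPaper.mem_far.2 ⟨?_, hw⟩) huw)
    rintro rfl
    exact (h.mem_far hu).2 huw.symm

theorem Conn.exists_boundary {C : Finset V} (h : Conn G Finset.univ) (hne : C.Nonempty)
    (hC : C ≠ Finset.univ) : ∃ u ∈ C, ∃ w, w ∉ C ∧ G.Adj u w := by
  by_contra! hcon
  refine hC (h.2 C (Finset.subset_univ _) hne ?_)
  intro u hu w _ huw
  by_contra hw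
  exact hcon u hu w hw huw

theorem Minimal.not_isComp_compl_singleton (hG : Minimal G) {x : V} {H : Finset V}
    (h : IsComp G {x}ᶜ H) : ¬ IsS G H := by
  intro hS
  refine hG.not_quarter (quarter_univ_of_remove (Y := {x}) (D₀ := {x}) hG.ih (by simp) ?_ ?_ ?_)
  · exact iso_of_card_undominated (p := x) (q := x) (by simp)
  · intro u hu hu'
    exact absurd ⟨u, hu, Or.inl rfl⟩ hu'
  · have hfil : (sComps G {x}ᶜ).filter (fun C => ∃ u ∈ C, Dom G {x} u) = sComps G {x}ᶜ := by
      rw [Finset.filter_eq_self]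
      intro C hC
      rw [mem_sComps] at hC
      obtain ⟨u, hu, w, hw, huw⟩ := hG.conn.exists_boundary hC.1.2.1.1 (by
        rintro rfl
        have := hC.1.1 (Finset.mem_univ x)
        simp at this)
      refine ⟨u, hu, x, by simp, Or.inr ?_⟩
      have : w = x := by
        by_contra hne
        exact hw (hC.1.2.2 u hu w (by simpa using hne) huw)
      exact this ▸ huw.symm
    have : 0 < (sComps G {x}ᶜ).card := Finset.card_pos.2 ⟨H, mem_sComps.2 ⟨h, hS⟩⟩
    rw [hfil]
    simp only [Finset.card_singleton]
    omega

theorem Minimal.exists_link (hG : Minimal G) {v : V} {H : Finset V} (h : IsComp G (far G v) H)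
    (hS : IsS G H) (x : V) : ∃ y, G.Adj v y ∧ y ≠ x ∧ ∃ u ∈ H, G.Adj y u := by
  by_contra! hcon
  have hb : ∀ u ∈ H, ∀ w, G.Adj u w → w ∉ H → w = x := by
    intro u hu w huw hw
    by_contra hne
    exact hcon w ((h.mem_or_adj hu huw).resolve_left hw) hne u hu huw.symm
  obtain ⟨u, hu, w, hw, huw⟩ := hG.conn.exists_boundary hS.nonempty (by
    rintro rfl
    exact (h.mem_far (Finset.mem_univ v)).1 rfl)
  obtain rfl := hb u hu w huw hw
  refine hG.not_isComp_compl_singleton (x := w) ⟨?_, h.2.1, ?_⟩ hS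
  · intro a ha
    simp only [Finset.mem_compl, Finset.mem_singleton]
    rintro rfl
    exact hw ha
  · intro a ha c hc hac
    by_contra hcH
    simp [hb a ha c hac hcH] at hc

theorem Minimal.link_structure (hG : Minimal G) {v : V} (hv : 3 ≤ (nb G v).card) :
    (∀ x ∈ nb G v, ∀ H ∈ sComps G (far G v), ∀ H' ∈ sComps G (far G v),
      (∃ u ∈ H, G.Adj x u) → (∃ u ∈ H', G.Adj x u) → H = H') ∧
    ((nb G v).card = 3 ∧ (sComps G (far G v)).card = 1 ∨
      (nb G v).card = 4 ∧ (sComps G (far G v)).card = 2 ∧ ∀ H ∈ sComps G (far G v),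
        ((nb G v).filter fun x => ∃ u ∈ H, G.Adj x u).card = 2) := by
  have key := bipartite_structure (N := nb G v) (S := sComps G (far G v))
    (R := fun x (H : Finset V) => ∃ u ∈ H, G.Adj x u) ?_ hv ?_
  · exact ⟨key.1, key.2.imp_right fun h => ⟨h.1, h.2.1, fun H hH => by convert h.2.2 H hH⟩⟩
  · intro H hH
    rw [mem_sComps] at hH
    obtain ⟨x, hx, -, hxu⟩ := hG.exists_link hH.1 hH.2 v
    obtain ⟨y, hy, hne, hyu⟩ := hG.exists_link hH.1 hH.2 x
    exact Finset.one_lt_card.2 ⟨x, by simp [hx]; exact hxu, y, by simp [hy]; exact hyu, hne.symm⟩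
  · intro X hX
    by_contra! hcon
    have hdom : ∀ u ∈ insert v (nb G v), Dom G (insert v X) u := by
      intro u hu
      rw [Finset.mem_insert, mem_nb] at hu
      exact ⟨v, by simp, hu⟩
    refine hG.not_quarter (quarter_univ_of_remove (Y := insert v (nb G v)) (D₀ := insert v X)
      hG.ih (by simp) ?_ ?_ ?_)
    · exact iso_of_card_undominated (p := v) (q := v) fun u hu hu' => absurd (hdom u hu) hu'
    · exact fun u hu hu' => absurd (hdom u hu) hu'
    · rw [← far_eq]
      have h1 : (insert v X).card ≤ X.card + 1 := Finset.card_insert_le _ _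
      have h2 : (insert v (nb G v)).card = (nb G v).card + 1 :=
        Finset.card_insert_of_notMem (by simp)
      have h3 : ((sComps G (far G v)).filter fun s => ∃ x ∈ X, ∃ u ∈ s, G.Adj x u).card ≤
          ((sComps G (far G v)).filter fun C => ∃ u ∈ C, Dom G (insert v X) u).card := by
        refine Finset.card_le_card fun C hC => ?_
        rw [Finset.mem_filter] at hC ⊢
        obtain ⟨hC, x, hx, u, hu, hxu⟩ := hC
        exact ⟨hC, u, hu, x, by simp [hx], Or.inr hxu⟩
      have h4 : 4 * X.card + (sComps G (far G v)).card + 3 ≤ (nb G v).card +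
          4 * ((sComps G (far G v)).filter fun s => ∃ x ∈ X, ∃ u ∈ s, G.Adj x u).card := by
        convert hcon
        rfl
      omega

theorem Minimal.exists_sComp (hG : Minimal G) {v : V} (hv : 3 ≤ (nb G v).card) :
    ∃ H, IsComp G (far G v) H ∧ IsS G H := by
  have : 0 < (sComps G (far G v)).card := by
    rcases (hG.link_structure hv).2 with h | h <;> omega
  obtain ⟨H, hH⟩ := Finset.card_pos.1 this
  exact ⟨H, mem_sComps.1 hH⟩

theorem IsCyc.interior_mem {H K : Finset V} {m : ℕ} {f : ℕ → V} (hf : IsCyc G H m f)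
    (hK : ∀ u ∈ K, ∀ w ∈ H, w ≠ f 0 → ¬ G.Adj (f 0) w → G.Adj u w → w ∈ K) {j : ℕ}
    (h2 : 2 ≤ j) (hj : j + 2 ≤ m) (hjK : f j ∈ K) {i : ℕ} (hi2 : 2 ≤ i) (hi : i + 2 ≤ m) :
    f i ∈ K := by
  have step : ∀ a b, 2 ≤ a → a + 2 ≤ m → 2 ≤ b → b + 2 ≤ m → (b = a + 1 ∨ a = b + 1) →
      f a ∈ K → f b ∈ K := by
    intro a b ha ha' hb hb' hab haK
    refine hK _ haK _ ((hf.1 _).2 ⟨b, by omega, rfl⟩)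
      (hf.2 0 b (by omega) (by omega)).1.symm ?_ ?_
    · rw [(hf.2 0 b (by omega) (by omega)).2]
      omega
    · rcases hab with h | h
      · rw [(hf.2 a b (by omega) (by omega)).2]
        exact Or.inl h
      · rw [G.adj_comm, (hf.2 b a (by omega) (by omega)).2]
        exact Or.inl h
  rcases le_total j i with hji | hij
  · induction i, hji using Nat.le_induction with
    | base => exact hjK
    | succ n hn ih =>
      exact step n (n + 1) (by omega) (by omega) hi2 hi (Or.inl rfl) (ih (by omega) (by omega))
  · induction j, hij using Nat.le_induction with
    | base => exact hjK
    | succ n hn ih =>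
      exact ih (by omega) (by omega) (step (n + 1) n h2 hj (by omega) (by omega) (Or.inr rfl) hjK)

theorem IsCyc.exists_index {H : Finset V} {m : ℕ} {f : ℕ → V} (hf : IsCyc G H m f) (hm : 3 ≤ m)
    {u : V} (hu : u ∈ H) (h0 : u ≠ f 0) (ha : ¬ G.Adj (f 0) u) :
    ∃ j, 2 ≤ j ∧ j + 2 ≤ m ∧ f j = u := by
  obtain ⟨j, hj, rfl⟩ := (hf.1 u).1 hu
  have hj0 : j ≠ 0 := by rintro rfl; exact h0 rfl
  rw [(hf.2 0 j (by omega) hj).2] at ha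
  exact ⟨j, by omega, by omega, rfl⟩

/-- A copy of a member of the family minus a closed neighbourhood has no component in the family. -/
theorem IsS.not_closed_of_subset {H K : Finset V} (hH : IsS G H) (hK : IsS G K) (hKH : K ⊆ H)
    {h : V} (hh : h ∈ H) (hfar : ∀ u ∈ K, u ≠ h ∧ ¬ G.Adj h u)
    (hcl : ∀ u ∈ K, ∀ w ∈ H, w ≠ h → ¬ G.Adj h w → G.Adj u w → w ∈ K) : False := by
  have hlt : K.card < H.card := Finset.card_lt_card ⟨hKH, fun hs => (hfar h (hs hh)).1 rfl⟩
  rcases hH.cases with ⟨a, b, c, hp⟩ | ⟨m, hm, hr⟩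
  · rw [hp.card] at hlt
    rcases hK.card with h | h | h <;> omega
  · obtain ⟨f, hf, rfl⟩ := hr.exists_isCyc hh
    rw [hr.card] at hlt
    obtain ⟨u, hu⟩ := hK.nonempty
    obtain ⟨j, hj2, hj, rfl⟩ := hf.exists_index (by omega) (hKH hu) (hfar u hu).1 (hfar u hu).2
    have h1 : H ⊆ K ∪ {f 0, f 1, f (m - 1)} := by
      intro w hw
      obtain ⟨i, hi, rfl⟩ := (hf.1 w).1 hw
      simp only [Finset.mem_union, Finset.mem_insert, Finset.mem_singleton]
      by_cases h0 : i = 0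
      · simp [h0]
      by_cases h1 : i = 1
      · simp [h1]
      by_cases h2 : i = m - 1
      · simp [h2]
      exact Or.inl (hf.interior_mem hcl hj2 hj hu (by omega) (by omega))
    have h3 : ({f 0, f 1, f (m - 1)} : Finset V).card = 3 :=
      Finset.card_eq_three.2 ⟨_, _, _, (hf.2 0 1 (by omega) (by omega)).1,
        (hf.2 0 (m - 1) (by omega) (by omega)).1, (hf.2 1 (m - 1) (by omega) (by omega)).1, rfl⟩
    have h4 : K ∪ {f 0, f 1, f (m - 1)} ⊆ H := by
      refine Finset.union_subset hKH ?_
      intro w hw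
      simp only [Finset.mem_insert, Finset.mem_singleton] at hw
      rw [hf.1]
      rcases hw with rfl | rfl | rfl
      · exact ⟨0, by omega, rfl⟩
      · exact ⟨1, by omega, rfl⟩
      · exact ⟨m - 1, by omega, rfl⟩
    have h5 : Disjoint K {f 0, f 1, f (m - 1)} := by
      rw [Finset.disjoint_left]
      intro w hw hw'
      simp only [Finset.mem_insert, Finset.mem_singleton] at hw'
      rcases hw' with rfl | rfl | rfl
      · exact (hfar _ hw).1 rfl
      · exact (hfar _ hw).2 ((hf.2 0 1 (by omega) (by omega)).2.2 (by simp))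
      · exact (hfar _ hw).2 ((hf.2 0 (m - 1) (by omega) (by omega)).2.2 (by omega))
    have h6 := congrArg Finset.card (h1.antisymm h4)
    rw [Finset.card_union_of_disjoint h5, h3, hr.card] at h6
    rcases hK.card with h | h | h <;> omega

theorem IsComp.eq_of_compl {v h : V} {H K : Finset V} (hH : IsComp G (far G v) H)
    (hK : IsComp G (far G h) K) (hh : h ∈ H) (hKv : ∀ u ∈ K, u ≠ v ∧ ¬ G.Adj v u)
    (hd : ∀ u ∈ K, u ∉ H) : IsComp G (far G v) K := by
  refine ⟨fun u hu => IsolationPaper.mem_far.2 (hKv u hu), hK.2.1, ?_⟩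
  intro u hu w hw huw
  rcases hK.mem_or_adj hu huw with h' | h'
  · exact h'
  · have hwH : w ∈ H := hH.2.2 h hh w hw h'
    exact absurd (hH.2.2 w hwH u (IsolationPaper.mem_far.2 (hKv u hu)) huw.symm) (hd u hu)

/-- The relation "`h` lies in a special component of `G - N[v]`" is symmetric. -/
theorem Minimal.mem_of_mem (hG : Minimal G) {v h : V} {H K : Finset V} (hv : 3 ≤ (nb G v).card)
    (hH : IsComp G (far G v) H) (hHS : IsS G H) (hh : h ∈ H)
    (hK : IsComp G (far G h) K) (hKS : IsS G K) : v ∈ K := by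
  by_contra hvK
  have hKv : ∀ u ∈ K, u ≠ v ∧ ¬ G.Adj v u := by
    intro u hu
    refine ⟨fun h => hvK (h ▸ hu), fun huv => hvK ?_⟩
    refine hK.2.2 u hu v (IsolationPaper.mem_far.2 ⟨(hH.mem_far hh).1.symm, fun h' => ?_⟩) huv.symm
    exact (hH.mem_far hh).2 h'.symm
  by_cases hKH : ∃ u ∈ K, u ∈ H
  · have hsub : K ⊆ H := hK.2.1.subset_of_closed hKH fun u _ huH w hw huw =>
      hH.2.2 u huH w (IsolationPaper.mem_far.2 (hKv w hw)) huw
    exact hHS.not_closed_of_subset hKS hsub hh (fun u hu => hK.mem_far hu)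
      fun u hu w _ h1 h2 huw => hK.2.2 u hu w (IsolationPaper.mem_far.2 ⟨h1, h2⟩) huw
  · push Not at hKH
    have hKc := hH.eq_of_compl hK hh hKv hKH
    obtain ⟨w, hw, -, u, hu, hwu⟩ := hG.exists_link hK hKS h
    have hvw : G.Adj v w := by
      rcases hH.mem_or_adj hh hw with h' | h'
      · exact absurd (hH.2.2 w h' u (IsolationPaper.mem_far.2 (hKv u hu)) hwu) (hKH u hu)
      · exact h'
    have := (hG.link_structure hv).1 w (mem_nb.2 hvw) H (mem_sComps.2 ⟨hH, hHS⟩) K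
      (mem_sComps.2 ⟨hKc, hKS⟩) ⟨h, hh, hw.symm⟩ ⟨u, hu, hwu⟩
    subst this
    exact hKH h hh hh

theorem Minimal.exists_three_le (hG : Minimal G) {v : V} {H : Finset V}
    (hH : IsComp G (far G v) H) (hHS : IsS G H) : ∃ h ∈ H, 3 ≤ (nb G h).card := by
  obtain ⟨x, hx, -, p, hp, hxp⟩ := hG.exists_link hH hHS v
  obtain ⟨y, hy, hyx, q, hq, hyq⟩ := hG.exists_link hH hHS x
  have hxH : x ∉ H := fun h => (hH.mem_far h).2 hx
  have hyH : y ∉ H := fun h => (hH.mem_far h).2 hy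
  have hvH : v ∉ H := fun h => (hH.mem_far h).1 rfl
  have two : ∀ r ∈ H, ∀ z, z ∉ H → G.Adj z r → ∀ s ∈ H, ∀ t ∈ H, s ≠ t → G.Adj r s → G.Adj r t →
      3 ≤ (nb G r).card := by
    intro r hr z hz hzr s hs t ht hst hrs hrt
    exact three_le_card_nb hzr.symm hrs hrt (fun h => hz (h ▸ hs)) (fun h => hz (h ▸ ht)) hst
  rcases hHS.cases with ⟨a, b, c, rfl, hac, hab, hbc, hnac⟩ | ⟨m, hm, hr⟩
  · have ha : a ∈ ({a, b, c} : Finset V) := by simp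
    have hb : b ∈ ({a, b, c} : Finset V) := by simp
    have hc : c ∈ ({a, b, c} : Finset V) := by simp
    have hpc : p = a ∨ p = b ∨ p = c := by simpa using hp
    have hqc : q = a ∨ q = b ∨ q = c := by simpa using hq
    have hbb : ∀ z, z ∉ ({a, b, c} : Finset V) → G.Adj z b → 3 ≤ (nb G b).card :=
      fun z hz hzb => two b hb z hz hzb a ha c hc hac hab.symm hbc
    have hsame : ∀ r ∈ ({a, b, c} : Finset V), ∀ s ∈ ({a, b, c} : Finset V), G.Adj r s →
        G.Adj x r → G.Adj y r → 3 ≤ (nb G r).card := by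
      intro r _ s hs hrs h1 h2
      exact three_le_card_nb h1.symm h2.symm hrs hyx.symm (fun h => hxH (h ▸ hs))
        (fun h => hyH (h ▸ hs))
    have hcyc : ∀ x y, G.Adj v x → G.Adj v y → y ≠ x → x ∉ ({a, b, c} : Finset V) →
        y ∉ ({a, b, c} : Finset V) → G.Adj x a → G.Adj y c → False := by
      intro x y hx hy hyx hxH hyH hxa hyc
      simp only [Finset.mem_insert, Finset.mem_singleton, not_or] at hxH hyH hvH
      exact hG.noC6 v x a b c y hx hxa hab hbc hyc.symm hy.symm (by grind) (by grind) (by grind)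
        (by grind) (by grind) (by grind) (by grind) (by grind) (by grind)
    rcases hpc with rfl | rfl | rfl
    · rcases hqc with rfl | rfl | rfl
      · exact ⟨_, hq, hsame _ hq _ hb hab hxp hyq⟩
      · exact ⟨_, hq, hbb y hyH hyq⟩
      · exact (hcyc x y hx hy hyx hxH hyH hxp hyq).elim
    · exact ⟨_, hp, hbb x hxH hxp⟩
    · rcases hqc with rfl | rfl | rfl
      · exact (hcyc y x hy hx hyx.symm hyH hxH hyq hxp).elim
      · exact ⟨_, hq, hbb y hyH hyq⟩
      · exact ⟨_, hq, hsame _ hq _ hb hbc.symm hxp hyq⟩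
  · obtain ⟨s, t, hs, ht, hst, hps, hpt, -⟩ := hr.nb_eq (by omega) hp
    exact ⟨p, hp, two p hp x hxH hxp s hs t ht hst hps hpt⟩

theorem Minimal.card_nb_le_three (hG : Minimal G) (v : V) : (nb G v).card ≤ 3 := by
  by_contra! hv
  obtain ⟨huniq, hst⟩ := hG.link_structure (v := v) (by omega)
  obtain ⟨h4, h2, hlinks⟩ : (nb G v).card = 4 ∧ (sComps G (far G v)).card = 2 ∧
      ∀ H ∈ sComps G (far G v), ((nb G v).filter fun x => ∃ u ∈ H, G.Adj x u).card = 2 := by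
    rcases hst with h | h
    · omega
    · exact h
  obtain ⟨H, H', hne, hHH⟩ := Finset.card_eq_two.1 h2
  have hHm : H ∈ sComps G (far G v) := by simp [hHH]
  have hHm' : H' ∈ sComps G (far G v) := by simp [hHH]
  obtain ⟨hH, hHS⟩ := mem_sComps.1 hHm
  obtain ⟨hH', hHS'⟩ := mem_sComps.1 hHm'
  obtain ⟨h, hh, hh3⟩ := hG.exists_three_le hH hHS
  obtain ⟨K, hK, hKS⟩ := hG.exists_sComp hh3
  have hvK : v ∈ K := hG.mem_of_mem (by omega) hH hHS hh hK hKS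
  let L := (nb G v).filter fun x => ∃ u ∈ H, G.Adj x u
  let Y := (nb G v).filter fun x => ¬ G.Adj h x
  have hYK : ∀ y ∈ Y, y ∈ K := by
    intro y hy
    simp only [Y, Finset.mem_filter, mem_nb] at hy
    refine hK.2.2 v hvK y (IsolationPaper.mem_far.2 ⟨?_, hy.2⟩) hy.1
    rintro rfl
    exact (hH.mem_far hh).2 hy.1
  have hYv : ∀ y ∈ Y, G.Adj v y := fun y hy => mem_nb.1 (Finset.mem_filter.1 hy).1
  have hYle : Y.card ≤ 2 := by
    by_contra! hc
    obtain ⟨a, b, c, ha, hb, hc, hab, hac, hbc⟩ := Finset.two_lt_card_iff.1 hc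
    rcases hKS.eq_or_eq hvK (hYK a ha) (hYK b hb) (hYK c hc) hab (hYv a ha) (hYv b hb)
      (hYv c hc) with h | h
    · exact hac h.symm
    · exact hbc h.symm
  have hLc : L.card = 2 := hlinks H hHm
  have hLY : (nb G v) \ L ⊆ Y := by
    intro y hy
    simp only [L, Y, Finset.mem_sdiff, Finset.mem_filter, mem_nb] at hy ⊢
    exact ⟨hy.1, fun h' => hy.2 ⟨hy.1, h, hh, h'.symm⟩⟩
  have hLs : ((nb G v) \ L).card = 2 := by
    rw [Finset.card_sdiff_of_subset (show L ⊆ nb G v from Finset.filter_subset _ _)]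
    omega
  have hYeq : (nb G v) \ L = Y := Finset.eq_of_subset_of_card_le hLY (by omega)
  have hL' : ∀ x, G.Adj v x → (∃ u ∈ H', G.Adj x u) → x ∈ Y := by
    intro x hx hxu
    rw [← hYeq, Finset.mem_sdiff, mem_nb]
    refine ⟨hx, fun hxL => hne ?_⟩
    exact huniq x (mem_nb.2 hx) H hHm H' hHm' (Finset.mem_filter.1 hxL).2 hxu
  have hLsub : Y = (nb G v).filter fun x => ∃ u ∈ H', G.Adj x u := by
    refine (Finset.eq_of_subset_of_card_le ?_ ?_).symm
    · intro x hx
      rw [Finset.mem_filter, mem_nb] at hx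
      exact hL' x hx.1 hx.2
    · rw [hlinks H' hHm', ← hYeq, hLs]
  have hYH' : ∀ y ∈ Y, ∃ u ∈ H', G.Adj y u := by
    intro y hy
    rw [hLsub] at hy
    exact (Finset.mem_filter.1 hy).2
  have hH'far : ∀ u ∈ H', u ∈ far G h := by
    intro u hu
    rw [mem_far]
    constructor
    · rintro rfl
      exact hne (hH.eq hH' hh hu)
    · intro hhu
      exact hne (hH.eq hH' (hH.2.2 h hh u (hH'.1 hu) hhu) hu)
  have hYne : Y.Nonempty := by
    rw [← Finset.card_pos, ← hYeq]
    omega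
  have hH'K : H' ⊆ K := by
    obtain ⟨y, hy⟩ := hYne
    obtain ⟨u, hu, hyu⟩ := hYH' y hy
    refine hH'.2.1.subset_of_closed ⟨u, hu, hK.2.2 y (hYK y hy) u (hH'far u hu) hyu⟩ ?_
    intro a _ haK w hw haw
    exact hK.2.2 a haK w (hH'far w hw) haw
  have hvH' : v ∉ H' := fun h => (hH'.mem_far h).1 rfl
  have hKeq : K ⊆ insert v (Y ∪ H') := by
    refine hK.2.1.subset_of_closed ⟨v, hvK, by simp⟩ ?_
    intro a ha ha' w hw haw
    simp only [Finset.mem_insert, Finset.mem_union] at ha' ⊢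
    rcases ha' with rfl | haY | haH
    · refine Or.inr (Or.inl (Finset.mem_filter.2 ⟨mem_nb.2 haw, (hK.mem_far hw).2⟩))
    · obtain ⟨u, hu, hau⟩ := hYH' a haY
      rcases hKS.eq_or_eq ha hvK (hH'K hu) hw (fun h => hvH' (h ▸ hu)) (hYv a haY).symm hau haw
        with rfl | rfl
      · exact Or.inl rfl
      · exact Or.inr (Or.inr hu)
    · rcases hH'.mem_or_adj haH haw with h' | h'
      · exact Or.inr (Or.inr h')
      · exact Or.inr (Or.inl (hL' w h' ⟨a, haH, haw.symm⟩))
  have hKeq' : insert v (Y ∪ H') ⊆ K := by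
    refine Finset.insert_subset hvK (Finset.union_subset hYK hH'K)
  have hdisj : Disjoint Y H' :=
    Finset.disjoint_left.2 fun y hy hy' => (hH'.mem_far hy').2 (hYv y hy)
  have hvY : v ∉ Y ∪ H' := by
    rw [Finset.mem_union, not_or]
    exact ⟨fun h => (hYv v h).ne rfl, hvH'⟩
  have hcard := congrArg Finset.card (hKeq.antisymm hKeq')
  rw [Finset.card_insert_of_notMem hvY, Finset.card_union_of_disjoint hdisj, ← hYeq, hLs] at hcard
  rcases hKS.card with h | h | h <;> rcases hHS'.card with h' | h' | h' <;> omega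

/-- A vertex with a single neighbour in a member of the family is an end of a copy of `P_3`. -/
theorem IsS.eq_of_unique {H : Finset V} (hS : IsS G H) {h b : V} (hh : h ∈ H)
    (hhb : G.Adj h b) (hu : ∀ w ∈ H, G.Adj h w → w = b) :
    ∃ c, H = {h, b, c} ∧ G.Adj b c ∧ ¬ G.Adj h c ∧ h ≠ c := by
  rcases hS.cases with ⟨p, q, r, rfl, hpr, hpq, hqr, hnpr⟩ | ⟨m, hm, hr⟩
  · simp only [Finset.mem_insert, Finset.mem_singleton] at hh hu
    rcases hh with rfl | rfl | rfl
    · obtain rfl := hu q (by simp) hpq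
      exact ⟨r, rfl, hqr, hnpr, hpr⟩
    · have h1 := hu p (by simp) hpq.symm
      have h2 := hu r (by simp) hqr
      exact absurd (h1.trans h2.symm) hpr
    · obtain rfl := hu q (by simp) hqr.symm
      refine ⟨p, ?_, hpq.symm, fun h => hnpr h.symm, hpr.symm⟩
      ext u
      simp only [Finset.mem_insert, Finset.mem_singleton]
      tauto
  · obtain ⟨p, q, hp, hq, hpq, hhp, hhq, -⟩ := hr.nb_eq (by omega) hh
    exact absurd ((hu p hp hhp).trans (hu q hq hhq).symm) hpq

/-- A member of the family minus a vertex of degree two is a path starting at any given neighbour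
of that vertex, or two isolated vertices. -/
theorem IsS.exists_arm {H : Finset V} (hS : IsS G H) {h g g' : V} (hh : h ∈ H) (hg : g ∈ H)
    (hg' : g' ∈ H) (hhg : G.Adj h g) (hhg' : G.Adj h g') (hne : g ≠ g')
    (hng : H.card = 3 → ¬ G.Adj g g') :
    ∃ (i t : ℕ) (f : ℕ → V), H.card + 1 = 4 * i ∧
      (i = 1 ∧ t = 1 ∨ i = 2 ∧ t = 6 ∨ i = 3 ∧ t = 10) ∧ f 0 = g ∧ (∀ a < t, f a ∈ H) ∧
      (∀ a < t, 0 < a → f a ≠ g) ∧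
      (∀ a b, a < b → b < t → (G.Adj (f a) (f b) ↔ b = a + 1)) ∧
      ∀ u ∈ H, u ≠ h → (∃ a < t, f a = u) ∨ (u ≠ g ∧ ∀ w ∈ H, G.Adj u w → w = h) := by
  by_cases h3 : H.card = 3
  · refine ⟨1, 1, fun _ => g, by omega, by simp, rfl, by simpa, by omega, by omega, ?_⟩
    have hH : H = {h, g, g'} := by
      refine (Finset.eq_of_subset_of_card_le ?_ ?_).symm
      · intro u hu
        simp only [Finset.mem_insert, Finset.mem_singleton] at hu
        rcases hu with rfl | rfl | rfl <;> assumption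
      · rw [h3, Finset.card_eq_three.2 ⟨h, g, g', hhg.ne, hhg'.ne, hne, rfl⟩]
    intro u hu huh
    rw [hH] at hu
    simp only [Finset.mem_insert, Finset.mem_singleton] at hu
    rcases hu with rfl | rfl | rfl
    · exact absurd rfl huh
    · exact Or.inl ⟨0, by omega, rfl⟩
    · refine Or.inr ⟨hne.symm, ?_⟩
      intro w hw huw
      rw [hH] at hw
      simp only [Finset.mem_insert, Finset.mem_singleton] at hw
      rcases hw with rfl | rfl | rfl
      · rfl
      · exact absurd huw.symm (hng h3)
      · exact absurd huw (G.loopless.irrefl _)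
  · rcases hS.cases with ⟨a, b, c, hp⟩ | ⟨m, hm, hr⟩
    · exact absurd hp.card h3
    · rw [hr.card] at h3
      obtain ⟨f, hf, rfl, rfl⟩ := hr.1 h hh g hg hhg
      refine ⟨(m + 1) / 4, m - 1, fun i => f (i + 1), ?_, ?_, rfl, ?_, ?_, ?_, ?_⟩
      · rw [hr.card]; omega
      · omega
      · exact fun a ha => (hf.1 _).2 ⟨a + 1, by omega, rfl⟩
      · exact fun a ha ha0 => (hf.2 1 (a + 1) (by omega) (by omega)).1.symm
      · intro a b hab hb
        rw [(hf.2 (a + 1) (b + 1) (by omega) (by omega)).2]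
        omega
      · intro u hu hne
        obtain ⟨i, hi, rfl⟩ := (hf.1 u).1 hu
        have : i ≠ 0 := by rintro rfl; exact hne rfl
        refine Or.inl ⟨i - 1, by omega, ?_⟩
        simp only
        congr 1; omega

/-- Two vertices of degree three, each in the special component of the other one. -/
structure Pair (G : SimpleGraph V) (v h : V) (H K : Finset V) : Prop where
  compH : IsComp G (far G v) H
  isSH : IsS G H
  memH : h ∈ H
  compK : IsComp G (far G h) K
  isSK : IsS G K
  memK : v ∈ K

theorem Pair.symm {v h : V} {H K : Finset V} (P : Pair G v h H K) : Pair G h v K H :=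
  ⟨P.compK, P.isSK, P.memK, P.compH, P.isSH, P.memH⟩

theorem Pair.mem_of_adj {v h w : V} {H K : Finset V} (P : Pair G v h H K) (hw : G.Adj v w)
    (hw' : ¬ G.Adj h w) : w ∈ K := (P.compK.mem_or_adj P.memK hw).resolve_right hw'

theorem Minimal.false_of_two_common (hG : Minimal G) {v h x y b z : V} {H K : Finset V}
    (P : Pair G v h H K) (hv3 : 3 ≤ (nb G v).card) (hxy : x ≠ y)
    (hv : ∀ w, G.Adj v w ↔ w = x ∨ w = y ∨ w = z) (hh : ∀ w, G.Adj h w ↔ w = x ∨ w = y ∨ w = b)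
    (hzx : z ≠ x) (hzy : z ≠ y) (hbx : b ≠ x) (hby : b ≠ y) : False := by
  have hnv : ∀ u ∈ H, u ≠ v ∧ ¬ G.Adj v u := fun u hu => P.compH.mem_far hu
  have hnh : ∀ u ∈ K, u ≠ h ∧ ¬ G.Adj h u := fun u hu => P.compK.mem_far hu
  obtain ⟨c, hHeq, hbc, hhc, hhc'⟩ := P.isSH.eq_of_unique P.memH ((hh b).2 (by simp)) (by
    intro w hw hhw
    have := (hnv w hw).2
    rw [hv] at this
    rw [hh] at hhw
    tauto)
  obtain ⟨w, hKeq, hzw, hvw, hvw'⟩ := P.isSK.eq_of_unique P.memK ((hv z).2 (by simp)) (by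
    intro w hw hhw
    have := (hnh w hw).2
    rw [hh] at this
    rw [hv] at hhw
    tauto)
  have hbH : b ∈ H := by simp [hHeq]
  have hcH : c ∈ H := by simp [hHeq]
  have hzK : z ∈ K := by simp [hKeq]
  have hwK : w ∈ K := by simp [hKeq]
  have hvx := (hv x).2 (by simp)
  have hvy := (hv y).2 (by simp)
  have hvz := (hv z).2 (by simp)
  have hhx := (hh x).2 (by simp)
  have hhy := (hh y).2 (by simp)
  have hhb := (hh b).2 (by simp)
  have n1 := hnv h P.memH
  have n2 := hnv b hbH
  have n3 := hnv c hcH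
  have n4 := hnh z hzK
  have n5 := hnh w hwK
  have hcw : c ≠ w := by
    rintro rfl
    exact hG.noC6 v x h b c z hvx hhx.symm hhb hbc hzw.symm hvz.symm n1.1.symm n2.1.symm n3.1.symm
      hbx.symm (fun e => n3.2 (e ▸ hvx)) hzx.symm hhc' n4.1.symm
      (fun e => n2.2 (e ▸ hvz))
  have hnd : [v, h, x, y, b, c, z, w].Nodup := by
    simp only [List.nodup_cons, List.mem_cons, List.not_mem_nil, or_false, not_or,
      List.nodup_nil, and_true, not_false_eq_true]
    exact ⟨⟨n1.1.symm, hvx.ne, hvy.ne, n2.1.symm, n3.1.symm, hvz.ne, hvw'⟩,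
      ⟨hhx.ne, hhy.ne, hhb.ne, hhc', n4.1.symm, n5.1.symm⟩,
      ⟨hxy, hbx.symm, fun e => n3.2 (e ▸ hvx), hzx.symm, fun e => n5.2 (e ▸ hhx)⟩,
      ⟨hby.symm, fun e => n3.2 (e ▸ hvy), hzy.symm, fun e => n5.2 (e ▸ hhy)⟩,
      ⟨hbc.ne, fun e => n2.2 (e ▸ hvz), fun e => n5.2 (e ▸ hhb)⟩,
      ⟨fun e => n3.2 (e ▸ hvz), hcw⟩, hzw.ne⟩
  let Y : Finset V := [v, h, x, y, b, c, z, w].toFinset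
  have hYc : Y.card = 8 := List.toFinset_card_of_nodup hnd
  have hYm : ∀ u, u ∈ Y ↔ u = v ∨ u = h ∨ u = x ∨ u = y ∨ u = b ∨ u = c ∨ u = z ∨ u = w := by
    intro u
    simp [Y]
  have hund : ∀ u ∈ Y, ¬ Dom G {v, h} u → u = c ∨ u = w := by
    intro u hu hd
    have d1 : ∀ u, u = v ∨ G.Adj v u → Dom G {v, h} u := fun u h => ⟨v, by simp, h⟩
    have d2 : ∀ u, u = h ∨ G.Adj h u → Dom G {v, h} u := fun u h' => ⟨h, by simp, h'⟩
    rcases (hYm u).1 hu with rfl | rfl | rfl | rfl | rfl | rfl | rfl | rfl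
    · exact absurd (d1 _ (Or.inl rfl)) hd
    · exact absurd (d2 _ (Or.inl rfl)) hd
    · exact absurd (d1 _ (Or.inr hvx)) hd
    · exact absurd (d1 _ (Or.inr hvy)) hd
    · exact absurd (d2 _ (Or.inr hhb)) hd
    · exact Or.inl rfl
    · exact absurd (d1 _ (Or.inr hvz)) hd
    · exact Or.inr rfl
  have hHY : ∀ u ∈ H, u ∈ Y := by
    intro u hu
    rw [hHeq] at hu
    simp only [Finset.mem_insert, Finset.mem_singleton] at hu
    rcases hu with rfl | rfl | rfl <;> exact (hYm _).2 (by simp)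
  have hKY : ∀ u ∈ K, u ∈ Y := by
    intro u hu
    rw [hKeq] at hu
    simp only [Finset.mem_insert, Finset.mem_singleton] at hu
    rcases hu with rfl | rfl | rfl <;> exact (hYm _).2 (by simp)
  have hvY : ∀ u, G.Adj v u → u ∈ Y := by
    intro u hu
    rcases (hv u).1 hu with rfl | rfl | rfl <;> exact (hYm _).2 (by simp)
  have hhY : ∀ u, G.Adj h u → u ∈ Y := by
    intro u hu
    rcases (hh u).1 hu with rfl | rfl | rfl <;> exact (hYm _).2 (by simp)
  have hHn : ∀ u ∈ H, ∀ t, G.Adj u t → t ∈ Y := fun u hu t hut =>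
    (P.compH.mem_or_adj hu hut).elim (hHY t) (hvY t)
  have hKn : ∀ u ∈ K, ∀ t, G.Adj u t → t ∈ Y := fun u hu t hut =>
    (P.compK.mem_or_adj hu hut).elim (hKY t) (hhY t)
  refine hG.not_quarter (quarter_univ_of_remove (Y := Y) (D₀ := {v, h}) hG.ih
    ⟨v, (hYm v).2 (Or.inl rfl)⟩ (iso_of_card_undominated hund) ?_ ?_)
  · intro u hu hd t hut
    rcases hund u hu hd with rfl | rfl
    · exact hHn _ hcH t hut
    · exact hKn _ hwK t hut
  · have hempty : sComps G Yᶜ = ∅ := by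
      rw [Finset.eq_empty_iff_forall_notMem]
      intro C hC
      rw [mem_sComps] at hC
      obtain ⟨hC, hCS⟩ := hC
      have hCY : ∀ u ∈ C, u ∉ Y := fun u hu => Finset.mem_compl.1 (hC.1 hu)
      have hCv : IsComp G (far G v) C := by
        refine ⟨?_, hC.2.1, ?_⟩
        · intro u hu
          rw [mem_far]
          exact ⟨fun h => hCY u hu ((hYm u).2 (Or.inl h)), fun h => hCY u hu (hvY u h)⟩
        · intro u hu t ht hut
          rw [mem_far] at ht
          refine hC.2.2 u hu t (Finset.mem_compl.2 fun htY => ?_) hut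
          rcases (hYm t).1 htY with rfl | rfl | rfl | rfl | rfl | rfl | rfl | rfl
          · exact ht.1 rfl
          · exact hCY u hu (hhY u hut.symm)
          · exact ht.2 hvx
          · exact ht.2 hvy
          · exact hCY u hu (hHn _ hbH u hut.symm)
          · exact hCY u hu (hHn _ hcH u hut.symm)
          · exact ht.2 hvz
          · exact hCY u hu (hKn _ hwK u hut.symm)
      have hone : (sComps G (far G v)).card = 1 := by
        rcases (hG.link_structure hv3).2 with h | h
        · exact h.2
        · have := hG.card_nb_le_three v
          omega
      have hCH := Finset.card_le_one.1 hone.le C (mem_sComps.2 ⟨hCv, hCS⟩) H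
        (mem_sComps.2 ⟨P.compH, P.isSH⟩)
      exact hCY h (hCH ▸ P.memH) (hHY h P.memH)
    rw [hempty, hYc]
    have : ({v, h} : Finset V).card ≤ 2 := Finset.card_le_two
    simp only [Finset.card_empty]
    omega

/-- A pair with exactly one common neighbour `x`. -/
structure Cross (G : SimpleGraph V) (v h x y z g g' : V) (H K : Finset V) : Prop
    extends Pair G v h H K where
  adjv : ∀ w, G.Adj v w ↔ w = x ∨ w = y ∨ w = z
  adjh : ∀ w, G.Adj h w ↔ w = x ∨ w = g ∨ w = g'
  memy : y ∈ K
  memz : z ∈ K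
  memg : g ∈ H
  memg' : g' ∈ H
  yz : y ≠ z
  gg' : g ≠ g'

namespace Cross

variable {v h x y z g g' : V} {H K : Finset V}

theorem swap (C : Cross G v h x y z g g' H K) : Cross G h v x g g' y z K H :=
  ⟨C.toPair.symm, C.adjh, C.adjv, C.memg, C.memg', C.memy, C.memz, C.gg', C.yz⟩

theorem flip (C : Cross G v h x y z g g' H K) : Cross G v h x y z g' g H K :=
  ⟨C.toPair, C.adjv, fun w => by rw [C.adjh]; tauto, C.memy, C.memz, C.memg', C.memg, C.yz,
    C.gg'.symm⟩

theorem vx (C : Cross G v h x y z g g' H K) : G.Adj v x := (C.adjv x).2 (by simp)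
theorem vy (C : Cross G v h x y z g g' H K) : G.Adj v y := (C.adjv y).2 (by simp)
theorem vz (C : Cross G v h x y z g g' H K) : G.Adj v z := (C.adjv z).2 (by simp)
theorem hx (C : Cross G v h x y z g g' H K) : G.Adj h x := (C.adjh x).2 (by simp)
theorem hg (C : Cross G v h x y z g g' H K) : G.Adj h g := (C.adjh g).2 (by simp)
theorem hg' (C : Cross G v h x y z g g' H K) : G.Adj h g' := (C.adjh g').2 (by simp)

theorem notMem (C : Cross G v h x y z g g' H K) : v ∉ H ∧ x ∉ H ∧ y ∉ H ∧ z ∉ H :=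
  ⟨fun h => (C.compH.mem_far h).1 rfl, fun h => (C.compH.mem_far h).2 C.vx,
    fun h => (C.compH.mem_far h).2 C.vy, fun h => (C.compH.mem_far h).2 C.vz⟩

theorem mem_or (C : Cross G v h x y z g g' H K) {u w : V} (hu : u ∈ H) (huw : G.Adj u w) :
    w ∈ H ∨ w = x ∨ w = y ∨ w = z :=
  (C.compH.mem_or_adj hu huw).imp_right (C.adjv w).1

theorem eq_of_card (C : Cross G v h x y z g g' H K) (h3 : H.card = 3) : H = {h, g, g'} := by
  refine (Finset.eq_of_subset_of_card_le ?_ ?_).symm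
  · intro u hu
    simp only [Finset.mem_insert, Finset.mem_singleton] at hu
    rcases hu with rfl | rfl | rfl
    · exact C.memH
    · exact C.memg
    · exact C.memg'
  · rw [h3, Finset.card_eq_three.2 ⟨h, g, g', C.hg.ne, C.hg'.ne, C.gg', rfl⟩]

theorem disjoint (C : Cross G v h x y z g g' H K) (hG : NoC6 G) : ∀ u ∈ H, u ∉ K := by
  intro u huH huK
  obtain ⟨hvH, hxH, hyH, hzH⟩ := C.notMem
  obtain ⟨hhK, hxK, hgK, hgK'⟩ := C.swap.notMem
  rcases C.isSH.cases with ⟨a, b, c, hp⟩ | ⟨m, hm, hr⟩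
  · rw [C.eq_of_card hp.card] at huH
    simp only [Finset.mem_insert, Finset.mem_singleton] at huH
    rcases huH with rfl | rfl | rfl <;> contradiction
  obtain ⟨f, hf, rfl⟩ := hr.exists_isCyc C.memH
  obtain ⟨hu0, hu1⟩ := C.compK.mem_far huK
  obtain ⟨j, hj2, hj, rfl⟩ := hf.exists_index (by omega) huH hu0 hu1
  have h2K : f 2 ∈ K := hf.interior_mem (fun u hu w _ h1 h2 huw =>
    C.compK.2.2 u hu w (mem_far.2 ⟨h1, h2⟩) huw) hj2 hj huK le_rfl (by omega)
  have h2H : f 2 ∈ H := (hf.1 _).2 ⟨2, by omega, rfl⟩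
  have h1H : f 1 ∈ H := (hf.1 _).2 ⟨1, by omega, rfl⟩
  have h01 : G.Adj (f 0) (f 1) := (hf.2 0 1 (by omega) (by omega)).2.2 (by simp)
  have h12 : G.Adj (f 1) (f 2) := (hf.2 1 2 (by omega) (by omega)).2.2 (by simp)
  have h02 : f 0 ≠ f 2 := (hf.2 0 2 (by omega) (by omega)).1
  have h1K : f 1 ∉ K := fun h => (C.compK.mem_far h).2 h01
  obtain ⟨w, hwK, hw3, h2w⟩ : ∃ w ∈ K, w ≠ f 3 ∧ G.Adj (f 2) w := by
    rcases C.isSK.cases with ⟨a, b, c, hp⟩ | ⟨n, hn, hrK⟩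
    · rw [C.swap.eq_of_card hp.card] at h2K
      simp only [Finset.mem_insert, Finset.mem_singleton] at h2K
      rcases h2K with h | h | h <;> rw [h] at h2H <;> contradiction
    · obtain ⟨p, q, hp, hq, hpq, h2p, h2q, -⟩ := hrK.nb_eq (by omega) h2K
      by_cases h : p = f 3
      · exact ⟨q, hq, fun h' => hpq (h.trans h'.symm), h2q⟩
      · exact ⟨p, hp, h, h2p⟩
  have hwH : w ∉ H := by
    intro hwH
    obtain ⟨i, hi, rfl⟩ := (hf.1 w).1 hwH
    rcases lt_trichotomy i 2 with hlt | rfl | hlt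
    · have := (hf.2 i 2 hlt (by omega)).2.1 h2w.symm
      have hi1 : i = 1 := by omega
      exact h1K (hi1 ▸ hwK)
    · exact G.loopless.irrefl _ h2w
    · have := (hf.2 2 i hlt hi).2.1 h2w
      have hi3 : i = 3 := by omega
      exact hw3 (by rw [hi3])
  have hvw : G.Adj v w := (C.compH.mem_or_adj h2H h2w).resolve_left hwH
  have h0H := C.memH
  exact hG v x (f 0) (f 1) (f 2) w C.vx C.hx.symm h01 h12 h2w hvw.symm (by grind) (by grind)
    (by grind) (by grind) (by grind) (by grind) h02 (by grind) (by grind)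

theorem no_matching (C : Cross G v h x y z g g' H K) (hG : NoC6 G) (h1 : G.Adj g y)
    (h2 : G.Adj g' z) : False := by
  obtain ⟨hvH, hxH, hyH, hzH⟩ := C.notMem
  have := C.memH
  have := C.memg
  have := C.memg'
  exact hG v y g h g' z C.vy h1.symm C.hg.symm C.hg' h2 C.vz.symm (by grind) (by grind) (by grind)
    (by grind) (by grind) C.yz C.gg' (by grind) (by grind)

/-- Deleting part of `H ∪ K ∪ {x}` leaves every component outside that set a component of
`G - x`. -/
theorem isComp_compl (C : Cross G v h x y z g g' H K) {Y T : Finset V}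
    (hY : Y ⊆ insert x (H ∪ K)) (hT : IsComp G Yᶜ T) (hd : ∀ u ∈ T, u ∉ H ∧ u ∉ K ∧ u ≠ x) :
    IsComp G {x}ᶜ T := by
  refine ⟨?_, hT.2.1, ?_⟩
  · intro u hu
    simpa using (hd u hu).2.2
  · intro u hu w hw huw
    refine hT.2.2 u hu w (Finset.mem_compl.2 fun hwY => ?_) huw
    have := hY hwY
    simp only [Finset.mem_insert, Finset.mem_union, Finset.mem_compl, Finset.mem_singleton]
      at this hw
    have hy := C.memy
    have hz := C.memz
    have hg := C.memg
    have hg' := C.memg'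
    rcases this with h | h | h
    · exact hw h
    · rcases C.mem_or h huw.symm with h' | rfl | rfl | rfl
      · exact (hd u hu).1 h'
      · exact (hd _ hu).2.2 rfl
      · exact (hd _ hu).2.1 hy
      · exact (hd _ hu).2.1 hz
    · rcases C.swap.mem_or h huw.symm with h' | rfl | rfl | rfl
      · exact (hd u hu).2.1 h'
      · exact (hd _ hu).2.2 rfl
      · exact (hd _ hu).1 hg
      · exact (hd _ hu).1 hg'

theorem false_of_double (C : Cross G v h x y z g g' H K) (hG : Minimal G) (h1 : G.Adj y g)
    (h2 : G.Adj y g') : False := by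
  obtain ⟨hvH, hxH, hyH, hzH⟩ := C.notMem
  obtain ⟨hhK, hxK, hgK, hgK'⟩ := C.swap.notMem
  have hhH := C.memH
  have hgH := C.memg
  have hgH' := C.memg'
  have hvK := C.memK
  have hyK := C.memy
  have hzK := C.memz
  have hvx := C.vx
  have hvy := C.vy
  have hvz := C.vz
  have hyn : ∀ w, G.Adj y w → w = v ∨ w = g ∨ w = g' := by
    intro w hw
    by_contra! hc
    have hsub : ({v, g, g', w} : Finset V) ⊆ nb G y := by
      intro u hu
      simp only [Finset.mem_insert, Finset.mem_singleton] at hu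
      rw [mem_nb]
      rcases hu with rfl | rfl | rfl | rfl
      · exact hvy.symm
      · exact h1
      · exact h2
      · exact hw
    have hc4 : ({v, g, g', w} : Finset V).card = 4 := by
      have hnd : [v, g, g', w].Nodup := by
        have := C.gg'
        simp only [List.nodup_cons, List.mem_cons, List.not_mem_nil, or_false, not_or,
          List.nodup_nil, and_true, not_false_eq_true]
        grind
      simpa using List.toFinset_card_of_nodup hnd
    have := Finset.card_le_card hsub
    have := hG.card_nb_le_three y
    omega
  have hKeq : K = {v, y, z} := by
    rcases C.isSK.cases with ⟨a, b, c, hp⟩ | ⟨n, hn, hrK⟩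
    · exact C.swap.eq_of_card hp.card
    · obtain ⟨p, q, hp, hq, hpq, h2p, h2q, -⟩ := hrK.nb_eq (by omega) hyK
      have e1 := hyn p h2p
      have e2 := hyn q h2q
      grind
  have hzn : ∀ w, G.Adj z w → w = v := by
    intro w hw
    rcases C.swap.mem_or hzK hw with h' | rfl | rfl | rfl
    · rw [hKeq] at h'
      simp only [Finset.mem_insert, Finset.mem_singleton] at h'
      rcases h' with rfl | rfl | rfl
      · rfl
      · have := hyn z hw.symm
        have := hvz.ne
        grind
      · exact absurd hw (G.loopless.irrefl _)
    · have hyx : y ≠ w := by grind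
      exact (hG.noC6 y g h w z v h1 C.hg.symm C.hx hw.symm hvz.symm hvy (by grind) hyx C.yz
        (by grind) (by grind) (by grind) (by grind) (by grind) (by grind)).elim
    · exact (C.flip.no_matching hG.noC6 h2.symm hw.symm).elim
    · exact (C.no_matching hG.noC6 h1.symm hw.symm).elim
  have hnd : [y, v, g, g', z].Nodup := by
    have := C.yz
    have := C.gg'
    have := hvy.ne
    have := hvz.ne
    simp only [List.nodup_cons, List.mem_cons, List.not_mem_nil, or_false, not_or,
      List.nodup_nil, and_true, not_false_eq_true]
    grind
  let Y : Finset V := [y, v, g, g', z].toFinset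
  have hYc : Y.card = 5 := List.toFinset_card_of_nodup hnd
  have hYm : ∀ u, u ∈ Y ↔ u = y ∨ u = v ∨ u = g ∨ u = g' ∨ u = z := by
    intro u
    simp [Y]
  have hund : ∀ u ∈ Y, ¬ Dom G {y} u → u = z ∨ u = z := by
    intro u hu hd
    have d : ∀ u, u = y ∨ G.Adj y u → Dom G {y} u := fun u h => ⟨y, by simp, h⟩
    rcases (hYm u).1 hu with rfl | rfl | rfl | rfl | rfl
    · exact absurd (d _ (Or.inl rfl)) hd
    · exact absurd (d _ (Or.inr hvy.symm)) hd
    · exact absurd (d _ (Or.inr h1)) hd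
    · exact absurd (d _ (Or.inr h2)) hd
    · exact Or.inl rfl
  refine hG.not_quarter (quarter_univ_of_remove (Y := Y) (D₀ := {y}) hG.ih
    ⟨y, (hYm y).2 (Or.inl rfl)⟩ (iso_of_card_undominated hund) ?_ ?_)
  · intro u hu hd t hut
    rcases hund u hu hd with rfl | rfl <;> exact (hYm t).2 (Or.inr (Or.inl (hzn t hut)))
  · have hxY : x ∉ Y := by
      rw [hYm]
      have := hvx.ne
      grind
    have hhY : h ∉ Y := by
      rw [hYm]
      have := C.hg.ne
      have := C.hg'.ne
      grind
    have hle : (sComps G Yᶜ).card ≤ 1 := by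
      rw [Finset.card_le_one]
      suffices hx : ∀ T ∈ sComps G Yᶜ, x ∈ T by
        intro T hT T' hT'
        exact (mem_sComps.1 hT).1.eq (mem_sComps.1 hT').1 (hx T hT) (hx T' hT')
      intro T hT
      obtain ⟨hT, hTS⟩ := mem_sComps.1 hT
      have hTY : ∀ u ∈ T, u ∉ Y := fun u hu => Finset.mem_compl.1 (hT.1 hu)
      by_contra hxT
      have hhT : h ∉ T := fun hhT => hxT (hT.2.2 h hhT x (Finset.mem_compl.2 hxY) C.hx)
      by_cases hTH : ∃ u ∈ T, u ∈ H
      · have hsub : T ⊆ H := by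
          refine hT.2.1.subset_of_closed hTH ?_
          intro u _ huH w hw huw
          rcases C.mem_or huH huw with h | rfl | rfl | rfl
          · exact h
          · exact absurd hw hxT
          · exact absurd ((hYm _).2 (by simp)) (hTY _ hw)
          · exact absurd ((hYm _).2 (by simp)) (hTY _ hw)
        refine C.isSH.not_closed_of_subset hTS hsub hhH ?_ ?_
        · intro u hu
          refine ⟨fun h => hhT (h ▸ hu), fun h => ?_⟩
          rcases (C.adjh u).1 h with rfl | rfl | rfl
          · exact hxT hu
          · exact hTY _ hu ((hYm _).2 (by simp))
          · exact hTY _ hu ((hYm _).2 (by simp))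
        · intro u hu w hw hwh hhw huw
          refine hT.2.2 u hu w (Finset.mem_compl.2 fun hwY => ?_) huw
          rcases (hYm w).1 hwY with rfl | rfl | rfl | rfl | rfl
          · exact hyH hw
          · exact hvH hw
          · exact hhw C.hg
          · exact hhw C.hg'
          · exact hzH hw
      · push Not at hTH
        refine hG.not_isComp_compl_singleton (C.isComp_compl (Y := Y) ?_ hT ?_) hTS
        · intro u hu
          rw [hYm] at hu
          simp only [Finset.mem_insert, Finset.mem_union]
          grind
        · intro u hu
          refine ⟨hTH u hu, fun huK => hTY u hu ?_, fun h => hxT (h ▸ hu)⟩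
          rw [hKeq] at huK
          simp only [Finset.mem_insert, Finset.mem_singleton] at huK
          rcases huK with rfl | rfl | rfl <;> exact (hYm _).2 (by simp)
    rw [hYc]
    simp only [Finset.card_singleton]
    omega

theorem false_of_single (C : Cross G v h x y z g g' H K) (hG : Minimal G) (hgy : G.Adj g y)
    (hed : ∀ u ∈ H, ∀ w ∈ K, G.Adj u w → u = g ∧ w = y) : False := by
  have hdj := C.disjoint hG.noC6
  obtain ⟨hvH, hxH, hyH, hzH⟩ := C.notMem
  obtain ⟨hhK, hxK, hgK, hgK'⟩ := C.swap.notMem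
  have hhH := C.memH
  have hgH := C.memg
  have hgH' := C.memg'
  have hvK := C.memK
  have hyK := C.memy
  have hzK := C.memz
  obtain ⟨i, t, f, hi, hit, hf0, hfH, hfg, hf, hfc⟩ := C.isSH.exists_arm hhH hgH hgH' C.hg C.hg'
    C.gg' (by
      intro _ hgg
      have := C.gg'
      exact hG.noC6 v x h g' g y C.vx C.hx.symm C.hg' hgg.symm hgy C.vy.symm (by grind) (by grind)
        (by grind) (by grind) (by grind) (by grind) C.hg.ne (by grind) (by grind))
  obtain ⟨j, s, e, hj, hjs, he0, heK, hey, he, hec⟩ := C.isSK.exists_arm hvK hyK hzK C.vy C.vz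
    C.yz (by
      intro _ hgg
      have := C.yz
      exact hG.noC6 h x v z y g C.hx C.vx.symm C.vz hgg.symm hgy.symm C.hg.symm (by grind)
        (by grind) (by grind) (by grind) (by grind) (by grind) C.vy.ne (by grind) (by grind))
  let F : ℕ → V := fun n => if n < t then f (t - 1 - n) else e (n - t)
  have hFl : ∀ n, n < t → F n = f (t - 1 - n) := fun n hn => if_pos hn
  have hFr : ∀ n, t ≤ n → F n = e (n - t) := fun n hn => if_neg (by omega)
  obtain ⟨D, hD, hiso⟩ := exists_iso_path (G := G) (f := F) (L := t + s) (by
    intro a b hab hb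
    by_cases hbt : b < t
    · rw [hFl a (by omega), hFl b hbt, G.adj_comm, hf _ _ (by omega) (by omega)]
      omega
    · by_cases hat : a < t
      · rw [hFl a hat, hFr b (by omega)]
        constructor
        · intro hadj
          obtain ⟨h1, h2⟩ := hed _ (hfH _ (by omega)) _ (heK _ (by omega)) hadj
          have h3 : ¬ 0 < t - 1 - a := fun h => hfg _ (by omega) h h1
          have h4 : ¬ 0 < b - t := fun h => hey _ (by omega) h h2
          omega
        · intro hba
          have h3 : t - 1 - a = 0 := by omega
          have h4 : b - t = 0 := by omega
          rw [h3, h4, hf0, he0]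
          exact hgy
      · rw [hFr a (by omega), hFr b (by omega), he _ _ (by omega) (by omega)]
        omega)
  have hFim : ∀ u, (∃ a < t, f a = u) ∨ (∃ a < s, e a = u) →
      u ∈ (Finset.range (t + s)).image F := by
    rintro u (⟨a, ha, rfl⟩ | ⟨a, ha, rfl⟩)
    · refine Finset.mem_image.2 ⟨t - 1 - a, Finset.mem_range.2 (by omega), ?_⟩
      rw [hFl _ (by omega)]
      congr 1; omega
    · refine Finset.mem_image.2 ⟨t + a, Finset.mem_range.2 (by omega), ?_⟩
      rw [hFr _ (by omega)]
      congr 1; omega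
  let Y : Finset V := insert x (H ∪ K)
  have hYm : ∀ u, u ∈ Y ↔ u = x ∨ u ∈ H ∨ u ∈ K := by
    intro u
    simp [Y]
  have hYc : Y.card = H.card + K.card + 1 := by
    rw [Finset.card_insert_of_notMem (by simp [hxH, hxK]),
      Finset.card_union_of_disjoint (Finset.disjoint_left.2 hdj)]
  have hdx : ∀ u, ¬ Dom G (insert x D) u → u ≠ x ∧ u ≠ h ∧ u ≠ v := by
    intro u hu
    refine ⟨?_, ?_, ?_⟩ <;> rintro rfl <;> apply hu
    · exact ⟨u, by simp, Or.inl rfl⟩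
    · exact ⟨x, by simp, Or.inr C.hx.symm⟩
    · exact ⟨x, by simp, Or.inr C.vx.symm⟩
  have him : ∀ u w, u ∈ Y → w ∈ Y → ¬ Dom G (insert x D) u → ¬ Dom G (insert x D) w →
      G.Adj u w → u ∈ (Finset.range (t + s)).image F := by
    intro u w hu hw hu' hw' huw
    obtain ⟨u1, u2, u3⟩ := hdx u hu'
    obtain ⟨w1, w2, w3⟩ := hdx w hw'
    apply hFim
    have hw := ((hYm w).1 hw).resolve_left w1
    rcases ((hYm u).1 hu).resolve_left u1 with huH | huK
    · refine Or.inl ((hfc u huH u2).resolve_right ?_)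
      rintro ⟨hug, hn⟩
      rcases hw with hwH | hwK
      · exact w2 (hn w hwH huw)
      · exact hug (hed u huH w hwK huw).1
    · refine Or.inr ((hec u huK u3).resolve_right ?_)
      rintro ⟨huy, hn⟩
      rcases hw with hwH | hwK
      · exact huy (hed w hwH u huK huw.symm).2
      · exact w3 (hn w hwK huw)
  refine hG.not_quarter (quarter_univ_of_remove (Y := Y) (D₀ := insert x D) hG.ih
    ⟨x, (hYm x).2 (Or.inl rfl)⟩ ?_ ?_ ?_)
  · intro a b c ha hb hc ha' hb' hc' hab hbc
    exact (hiso.mono subset_rfl (Finset.subset_insert x D)) a b c (him a b ha hb ha' hb' hab)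
      (him b c hb hc hb' hc' hbc) (him c b hc hb hc' hb' hbc.symm) ha' hb' hc' hab hbc
  · intro u hu hu' w huw
    rcases ((hYm u).1 hu).resolve_left (hdx u hu').1 with huH | huK
    · rcases C.mem_or huH huw with h | rfl | rfl | rfl
      · exact (hYm _).2 (Or.inr (Or.inl h))
      · exact (hYm _).2 (Or.inl rfl)
      · exact (hYm _).2 (Or.inr (Or.inr hyK))
      · exact (hYm _).2 (Or.inr (Or.inr hzK))
    · rcases C.swap.mem_or huK huw with h | rfl | rfl | rfl
      · exact (hYm _).2 (Or.inr (Or.inr h))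
      · exact (hYm _).2 (Or.inl rfl)
      · exact (hYm _).2 (Or.inr (Or.inl hgH))
      · exact (hYm _).2 (Or.inr (Or.inl hgH'))
  · have hempty : sComps G Yᶜ = ∅ := by
      rw [Finset.eq_empty_iff_forall_notMem]
      intro T hT
      obtain ⟨hT, hTS⟩ := mem_sComps.1 hT
      refine hG.not_isComp_compl_singleton (C.isComp_compl (Y := Y) subset_rfl hT ?_) hTS
      intro u hu
      have := Finset.mem_compl.1 (hT.1 hu)
      rw [hYm, not_or, not_or] at this
      exact ⟨this.2.1, this.2.2, this.1⟩
    have := Finset.card_insert_le x D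
    rw [hempty, hYc]
    simp only [Finset.card_empty]
    omega

theorem contradiction (C : Cross G v h x y z g g' H K) (hG : Minimal G) : False := by
  have hdj := C.disjoint hG.noC6
  have hyK := C.memy
  have hzK := C.memz
  have hgH := C.memg
  have hgH' := C.memg'
  obtain ⟨hvH, hxH, hyH, hzH⟩ := C.notMem
  obtain ⟨hhK, hxK, hgK, hgK'⟩ := C.swap.notMem
  have hed : ∀ u ∈ H, ∀ w ∈ K, G.Adj u w → (u = g ∨ u = g') ∧ (w = y ∨ w = z) := by
    intro u hu w hw huw
    have h1 := C.mem_or hu huw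
    have h2 := C.swap.mem_or hw huw.symm
    have := hdj u hu
    grind
  have main : ∀ {y z g g'}, Cross G v h x y z g g' H K → (∀ u ∈ H, ∀ w ∈ K, G.Adj u w →
      (u = g ∨ u = g') ∧ (w = y ∨ w = z)) → G.Adj g y → False := by
    intro y z g g' C hed hgy
    refine C.false_of_single hG hgy ?_
    intro u hu w hw huw
    obtain ⟨rfl | rfl, rfl | rfl⟩ := hed u hu w hw huw
    · exact ⟨rfl, rfl⟩
    · exact (C.swap.false_of_double hG hgy huw).elim
    · exact (C.false_of_double hG hgy.symm huw.symm).elim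
    · exact (C.no_matching hG.noC6 hgy huw).elim
  have C' : Cross G v h x z y g g' H K := C.swap.flip.swap
  obtain ⟨w, hvw, hwx, u, hu, hwu⟩ := hG.exists_link C.compH C.isSH x
  have hwK : w ∈ K := by
    rcases (C.adjv w).1 hvw with rfl | rfl | rfl <;> tauto
  obtain ⟨rfl | rfl, rfl | rfl⟩ := hed u hu w hwK hwu.symm
  · exact main C hed hwu.symm
  · exact main C' (fun u hu w hw huw => by have := hed u hu w hw huw; tauto) hwu.symm
  · exact main C.flip (fun u hu w hw huw => by have := hed u hu w hw huw; tauto) hwu.symm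
  · exact main C'.flip (fun u hu w hw huw => by have := hed u hu w hw huw; tauto) hwu.symm

end Cross

theorem Minimal.card_nb_le_two (hG : Minimal G) (v : V) : (nb G v).card ≤ 2 := by
  by_contra! hv
  have hv3 : (nb G v).card = 3 := le_antisymm (hG.card_nb_le_three v) hv
  obtain ⟨H, hH, hHS⟩ := hG.exists_sComp hv
  obtain ⟨h, hh, hh3⟩ := hG.exists_three_le hH hHS
  obtain ⟨K, hK, hKS⟩ := hG.exists_sComp hh3
  have hvK := hG.mem_of_mem hv hH hHS hh hK hKS
  have P : Pair G v h H K := ⟨hH, hHS, hh, hK, hKS, hvK⟩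
  have hh3' : (nb G h).card = 3 := le_antisymm (hG.card_nb_le_three h) hh3
  have hX1 : ∃ x, G.Adj h x ∧ G.Adj v x := by
    by_contra! hc
    obtain ⟨a, b, c, ha, hb, hc', hab, hac, hbc⟩ := Finset.two_lt_card_iff.1 hh3
    rw [mem_nb] at ha hb hc'
    have hm : ∀ w, G.Adj h w → w ∈ H := fun w hw => P.symm.mem_of_adj hw (hc w hw)
    rcases hHS.eq_or_eq hh (hm a ha) (hm b hb) (hm c hc') hab ha hb hc' with h | h
    · exact hac h.symm
    · exact hbc h.symm
  have hX3 : ∃ b, G.Adj h b ∧ ¬ G.Adj v b := by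
    by_contra! hc
    have : H ⊆ {h} := by
      refine hH.2.1.subset_of_closed ⟨h, hh, by simp⟩ ?_
      intro u _ hu w hw huw
      rw [Finset.mem_singleton] at hu
      subst hu
      exact absurd (hc w huw) (hH.mem_far hw).2
    have := Finset.card_le_card this
    rw [Finset.card_singleton] at this
    rcases hHS.card with h | h | h <;> omega
  obtain ⟨x, hhx, hvx⟩ := hX1
  obtain ⟨b, hhb, hvb⟩ := hX3
  have third : ∀ {u p q : V}, (nb G u).card = 3 → G.Adj u p → G.Adj u q → p ≠ q →
      ∃ r, r ≠ p ∧ r ≠ q ∧ ∀ w, G.Adj u w ↔ w = p ∨ w = q ∨ w = r := by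
    intro u p q hu hp hq hpq
    have hsub : ({p, q} : Finset V) ⊆ nb G u := by
      intro w hw
      simp only [Finset.mem_insert, Finset.mem_singleton] at hw
      rcases hw with rfl | rfl <;> simpa
    have hc : (nb G u \ {p, q}).card = 1 := by
      rw [Finset.card_sdiff_of_subset hsub, hu, Finset.card_pair hpq]
    obtain ⟨r, hr⟩ := Finset.card_eq_one.1 hc
    have hr' : ∀ w, (G.Adj u w ∧ ¬ (w = p ∨ w = q)) ↔ w = r := by
      intro w
      rw [← Finset.mem_singleton (a := r), ← hr]
      simp
    have := (hr' r).2 rfl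
    refine ⟨r, by tauto, by tauto, fun w => ?_⟩
    have := hr' w
    constructor
    · tauto
    · rintro (rfl | rfl | rfl) <;> tauto
  have hxb : x ≠ b := by
    rintro rfl
    exact hvb hvx
  obtain ⟨r, hrx, hrb, hr⟩ := third hh3' hhx hhb hxb
  obtain ⟨y, hvy, hyx⟩ : ∃ y, G.Adj v y ∧ y ≠ x := by
    obtain ⟨a, b, ha, hb, hab⟩ := Finset.one_lt_card_iff.1 (by omega : 1 < (nb G v).card)
    rw [mem_nb] at ha hb
    by_cases h : a = x
    · exact ⟨b, hb, fun h' => hab (h.trans h'.symm)⟩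
    · exact ⟨a, ha, h⟩
  by_cases hvr : G.Adj v r
  · obtain ⟨z, hzx, hzr, hz⟩ := third hv3 hvx hvr hrx.symm
    exact hG.false_of_two_common P hv hrx.symm hz (fun w => by rw [hr]; tauto) hzx hzr hxb.symm
      hrb.symm
  · obtain ⟨z, hzx, hzy, hz⟩ := third hv3 hvx hvy hyx.symm
    have hnh : ∀ w, w ≠ x → G.Adj v w → ¬ G.Adj h w := by
      intro w hwx hvw hhw
      rcases (hr w).1 hhw with rfl | rfl | rfl <;> contradiction
    have hvz : G.Adj v z := (hz z).2 (by simp)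
    have C : Cross G v h x y z b r H K :=
      { toPair := P
        adjv := hz
        adjh := hr
        memy := P.mem_of_adj hvy (hnh y hyx hvy)
        memz := P.mem_of_adj hvz (hnh z hzx hvz)
        memg := P.symm.mem_of_adj hhb hvb
        memg' := P.symm.mem_of_adj ((hr r).2 (by simp)) hvr
        yz := hzy.symm
        gg' := hrb.symm }
    exact C.contradiction hG

/-- A connected graph with maximum degree at most two has a Hamiltonian path. -/
theorem exists_hamiltonian_path (hc : Conn G Finset.univ) (h2 : ∀ v, (nb G v).card ≤ 2) :
    ∃ f : ℕ → V, (∀ u, ∃ i < Fintype.card V, f i = u) ∧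
      (∀ i j, i < j → j < Fintype.card V → f i ≠ f j) ∧
      ∀ i, i + 1 < Fintype.card V → G.Adj (f i) (f (i + 1)) := by
  let P : ℕ → Prop := fun L => ∃ f : ℕ → V, (∀ i j, i < j → j < L → f i ≠ f j) ∧
    ∀ i, i + 1 < L → G.Adj (f i) (f (i + 1))
  have himg : ∀ L, ∀ f : ℕ → V, (∀ i j, i < j → j < L → f i ≠ f j) →
      ((Finset.range L).image f).card = L := by
    intro L f hf
    rw [Finset.card_image_of_injOn, Finset.card_range]
    intro i hi j hj hij
    simp only [Finset.coe_range, Set.mem_Iio] at hi hj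
    rcases lt_trichotomy i j with h | rfl | h
    · exact absurd hij (hf _ _ h hj)
    · rfl
    · exact absurd hij.symm (hf _ _ h hi)
  have hle : ∀ L, P L → L ≤ Fintype.card V := by
    rintro L ⟨f, hf, -⟩
    rw [← himg L f hf]
    exact Finset.card_le_univ _
  obtain ⟨v₀, -⟩ := hc.1
  have hP1 : P 1 := ⟨fun _ => v₀, by omega, by omega⟩
  obtain ⟨L, hL⟩ : ∃ L, L = Nat.findGreatest P (Fintype.card V) := ⟨_, rfl⟩
  have hPL : P L := hL ▸ Nat.findGreatest_spec (hle 1 hP1) hP1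
  have hmax : ¬ P (L + 1) := by
    intro h
    have := Nat.le_findGreatest (hle _ h) h
    omega
  have hL1 : 1 ≤ L := hL ▸ Nat.le_findGreatest (hle 1 hP1) hP1
  obtain ⟨f, hinj, hadj⟩ := hPL
  have hT : (Finset.range L).image f = Finset.univ := by
    refine hc.2 _ (Finset.subset_univ _) ⟨f 0, Finset.mem_image.2 ⟨0, by simpa, rfl⟩⟩ ?_
    intro u hu w _ huw
    by_contra hw
    have hw' : ∀ i < L, f i ≠ w := fun i hi h =>
      hw (Finset.mem_image.2 ⟨i, Finset.mem_range.2 hi, h⟩)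
    obtain ⟨i, hi, rfl⟩ := Finset.mem_image.1 hu
    rw [Finset.mem_range] at hi
    rcases Nat.eq_zero_or_pos i with rfl | hi0
    · refine hmax ⟨fun n => if n = 0 then w else f (n - 1), ?_, ?_⟩
      · intro i j hij hj
        simp only
        rw [if_neg (show ¬ j = 0 by omega)]
        split_ifs with h
        · exact (hw' _ (by omega)).symm
        · exact hinj _ _ (by omega) (by omega)
      · intro i hi
        simp only
        rw [if_neg (show ¬ i + 1 = 0 by omega)]
        split_ifs with h
        · subst h
          exact huw.symm
        · have := hadj (i - 1) (by omega)
          rw [show i - 1 + 1 = i by omega] at this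
          simpa using this
    · rcases Nat.lt_or_ge (i + 1) L with hlt | hge
      · have h1 := hadj (i - 1) (by omega)
        rw [show i - 1 + 1 = i by omega] at h1
        have := three_le_card_nb h1.symm (hadj i hlt) huw (hinj _ _ (by omega) hlt)
          (hw' _ (by omega)) (hw' _ hlt)
        have := h2 (f i)
        omega
      · refine hmax ⟨fun n => if n < L then f n else w, ?_, ?_⟩
        · intro a b hab hb
          simp only
          rw [if_pos (show a < L by omega)]
          split_ifs with h
          · exact hinj _ _ hab h
          · exact hw' _ (by omega)
        · intro a ha
          simp only
          rw [if_pos (show a < L by omega)]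
          split_ifs with h
          · exact hadj a h
          · have : a = i := by omega
            subst this
            exact huw
  have hcard : L = Fintype.card V := by
    rw [← himg L f hinj, hT, Finset.card_univ]
  rw [← hcard]
  refine ⟨f, fun u => ?_, hinj, hadj⟩
  have : u ∈ (Finset.range L).image f := hT ▸ Finset.mem_univ u
  simpa using this

theorem nonempty_iso_of_enumeration {n : ℕ} {K : SimpleGraph (Fin n)} {f : ℕ → V}
    (hsurj : ∀ u, ∃ i < n, f i = u) (hinj : ∀ i j, i < j → j < n → f i ≠ f j)
    (hadj : ∀ i j : Fin n, i < j → (G.Adj (f i) (f j) ↔ K.Adj i j)) : Nonempty (G ≃g K) := by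
  have hb : Function.Bijective fun i : Fin n => f i := by
    constructor
    · intro i j hij
      rcases lt_trichotomy i j with h | h | h
      · exact absurd hij (hinj _ _ h j.2)
      · exact h
      · exact absurd hij.symm (hinj _ _ h i.2)
    · intro u
      obtain ⟨i, hi, rfl⟩ := hsurj u
      exact ⟨⟨i, hi⟩, rfl⟩
  refine ⟨SimpleGraph.Iso.symm ⟨Equiv.ofBijective _ hb, ?_⟩⟩
  intro i j
  simp only [Equiv.ofBijective_apply]
  rcases lt_trichotomy i j with h | rfl | h
  · exact hadj i j h
  · simp
  · rw [G.adj_comm, K.adj_comm]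
    exact hadj j i h

/-- The cycle `C_n` can be isolated by `⌈n / 5⌉` vertices. -/
theorem exists_iso_cycle {f : ℕ → V} {n : ℕ} (hn : 3 ≤ n)
    (hf : ∀ i j, i < j → j < n → (G.Adj (f i) (f j) ↔ j = i + 1 ∨ (i = 0 ∧ j + 1 = n))) :
    ∃ D : Finset V, D.card ≤ (n + 4) / 5 ∧ Iso G ((Finset.range n).image f) D := by
  let D : Finset V := (Finset.range ((n + 4) / 5)).image fun q => f (5 * q)
  have hD : ∀ q, 5 * q < n → f (5 * q) ∈ D := fun q hq =>
    Finset.mem_image.2 ⟨q, Finset.mem_range.2 (by omega), rfl⟩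
  have hdom : ∀ i < n, ¬ Dom G D (f i) → (i % 5 = 2 ∨ i % 5 = 3) ∧ i + 1 < n := by
    intro i hi hd
    have h5 := hD (i / 5) (by omega)
    have h0 : i % 5 ≠ 0 := by
      intro h
      exact hd ⟨_, h5, Or.inl (by congr 1; omega)⟩
    have h1 : i % 5 ≠ 1 := by
      intro h
      refine hd ⟨_, h5, Or.inr ((hf _ _ (by omega) hi).2 (by omega))⟩
    have hlast : i + 1 < n := by
      by_contra hge
      refine hd ⟨_, hD 0 (by omega), Or.inr ((hf _ _ (by omega) hi).2 (by omega))⟩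
    have h4 : i % 5 ≠ 4 := by
      intro h
      refine hd ⟨_, hD (i / 5 + 1) (by omega), Or.inr (G.adj_symm ?_)⟩
      exact (hf i _ (by omega) (by omega)).2 (by omega)
    omega
  refine ⟨D, Finset.card_image_le.trans (Finset.card_range _).le, ?_⟩
  intro a b c ha hb hc ha' hb' hc' hab hbc
  obtain ⟨i, hi, rfl⟩ := Finset.mem_image.1 ha
  obtain ⟨j, hj, rfl⟩ := Finset.mem_image.1 hb
  obtain ⟨k, hk, rfl⟩ := Finset.mem_image.1 hc
  rw [Finset.mem_range] at hi hj hk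
  have h1 : ∀ i j, i < n → j < n → i ≠ 0 → j ≠ 0 → G.Adj (f i) (f j) → j = i + 1 ∨ i = j + 1 := by
    intro i j hi hj hi0 hj0 h
    rcases lt_trichotomy i j with h' | rfl | h'
    · have := (hf i j h' hj).1 h
      omega
    · exact absurd h (G.loopless.irrefl _)
    · have := (hf j i h' hi).1 h.symm
      omega
  have h2 := hdom i hi ha'
  have h3 := hdom j hj hb'
  have h4 := hdom k hk hc'
  rcases h1 i j hi hj (by omega) (by omega) hab with h | h <;>
    rcases h1 j k hj hk (by omega) (by omega) hbc with h' | h'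
  · omega
  · congr 1; omega
  · congr 1; omega
  · omega

theorem cycleGraph_adj_of_lt {n : ℕ} (hn : n = 1 ∨ n = 5 ∨ n = 9) (i j : Fin (n + 2)) (h : i < j) :
    (SimpleGraph.cycleGraph (n + 2)).Adj i j ↔
      j.val = i.val + 1 ∨ (i.val = 0 ∧ j.val + 1 = n + 2) := by
  rw [SimpleGraph.cycleGraph_adj]
  rcases hn with rfl | rfl | rfl
  · revert i j; decide
  · revert i j; decide
  · revert i j; decide

theorem quarter_of_card_nb_le_two (hc : Conn G Finset.univ) (h2 : ∀ v, (nb G v).card ≤ 2)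
    (h6 : NoC6 G) (hS : ¬ IsSGraph G) : Quarter G Finset.univ (Fintype.card V) := by
  obtain ⟨f, hsurj, hinj, hadj⟩ := exists_hamiltonian_path hc h2
  obtain ⟨n, hn⟩ : ∃ n, n = Fintype.card V := ⟨_, rfl⟩
  rw [← hn] at hsurj hinj hadj ⊢
  have himg : (Finset.range n).image f = Finset.univ := by
    ext u
    simpa using hsurj u
  have hchord : ∀ i j, i < j → j < n → G.Adj (f i) (f j) → j = i + 1 ∨ (i = 0 ∧ j + 1 = n) := by
    intro i j hij hj h
    by_contra hcon
    have hlow : ∀ v, ¬ 3 ≤ (nb G v).card := fun v => by have := h2 v; omega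
    rcases Nat.eq_zero_or_pos i with rfl | hi
    · have h1 := hadj (j - 1) (by omega)
      rw [show j - 1 + 1 = j by omega] at h1
      exact hlow _ (three_le_card_nb h.symm h1.symm (hadj j (by omega))
        (hinj _ _ (by omega) (by omega)) (hinj _ _ (by omega) (by omega))
        (hinj _ _ (by omega) (by omega)))
    · have h1 := hadj (i - 1) (by omega)
      rw [show i - 1 + 1 = i by omega] at h1
      exact hlow _ (three_le_card_nb h1.symm (hadj i (by omega)) h
        (hinj _ _ (by omega) (by omega)) (hinj _ _ (by omega) (by omega))
        (hinj _ _ (by omega) (by omega)))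
  by_cases hcyc : 3 ≤ n ∧ G.Adj (f 0) (f (n - 1))
  · obtain ⟨hn3, hcl⟩ := hcyc
    have hf : ∀ i j, i < j → j < n →
        (G.Adj (f i) (f j) ↔ j = i + 1 ∨ (i = 0 ∧ j + 1 = n)) := by
      intro i j hij hj
      refine ⟨hchord i j hij hj, ?_⟩
      rintro (rfl | ⟨rfl, hjn⟩)
      · exact hadj i hj
      · rw [show j = n - 1 by omega]
        exact hcl
    obtain ⟨D, hD, hi⟩ := exists_iso_cycle hn3 hf
    rw [himg] at hi
    have hiso : ∀ k, (k = 1 ∨ k = 5 ∨ k = 9) → n = k + 2 →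
        Nonempty (G ≃g SimpleGraph.cycleGraph (k + 2)) := by
      intro k hk hnk
      subst hnk
      refine nonempty_iso_of_enumeration hsurj hinj fun i j hij => ?_
      rw [hf _ _ hij j.2, cycleGraph_adj_of_lt hk i j hij]
    have n3 : n ≠ 3 := fun h => hS (Or.inr (Or.inl (hiso 1 (by simp) h)))
    have n7 : n ≠ 7 := fun h => hS (Or.inr (Or.inr (Or.inl (hiso 5 (by simp) h))))
    have n11 : n ≠ 11 := fun h => hS (Or.inr (Or.inr (Or.inr (hiso 9 (by simp) h))))
    have n6 : n ≠ 6 := by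
      rintro rfl
      exact h6 (f 0) (f 1) (f 2) (f 3) (f 4) (f 5) (hadj 0 (by omega)) (hadj 1 (by omega))
        (hadj 2 (by omega)) (hadj 3 (by omega)) (hadj 4 (by omega)) hcl.symm
        (hinj _ _ (by omega) (by omega)) (hinj _ _ (by omega) (by omega))
        (hinj _ _ (by omega) (by omega)) (hinj _ _ (by omega) (by omega))
        (hinj _ _ (by omega) (by omega)) (hinj _ _ (by omega) (by omega))
        (hinj _ _ (by omega) (by omega)) (hinj _ _ (by omega) (by omega))
        (hinj _ _ (by omega) (by omega))
    exact ⟨D, by omega, hi⟩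
  · have hf : ∀ i j, i < j → j < n → (G.Adj (f i) (f j) ↔ j = i + 1) := by
      intro i j hij hj
      constructor
      · intro h
        rcases hchord i j hij hj h with h' | ⟨rfl, hjn⟩
        · exact h'
        · by_contra hne
          refine hcyc ⟨by omega, ?_⟩
          rwa [show n - 1 = j by omega]
      · rintro rfl
        exact hadj i hj
    obtain ⟨D, hD, hi⟩ := exists_iso_path hf
    rw [himg] at hi
    have n3 : n ≠ 3 := by
      rintro rfl
      refine hS (Or.inl (nonempty_iso_of_enumeration hsurj hinj fun i j hij => ?_))
      rw [hf _ _ hij j.2, SimpleGraph.pathGraph_adj]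
      have : i.val < j.val := hij
      omega
    exact ⟨D, by omega, hi⟩

theorem Quarter.of_induce {C : Finset V} {m : ℕ}
    (h : Quarter (G.induce (C : Set V)) Finset.univ m) : Quarter G C m := by
  obtain ⟨D, hD, hi⟩ := h
  refine ⟨D.map (Function.Embedding.subtype _), by simpa using hD, ?_⟩
  have hd : ∀ u : (C : Set V), ¬ Dom G (D.map (Function.Embedding.subtype _)) u.1 →
      ¬ Dom (G.induce (C : Set V)) D u := by
    rintro u hu ⟨d, hd, h⟩
    refine hu ⟨d.1, Finset.mem_map.2 ⟨d, hd, rfl⟩, ?_⟩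
    exact h.imp (congrArg Subtype.val) id
  intro a b c ha hb hc ha' hb' hc' hab hbc
  exact congrArg Subtype.val (hi ⟨a, ha⟩ ⟨b, hb⟩ ⟨c, hc⟩ (Finset.mem_univ _) (Finset.mem_univ _)
    (Finset.mem_univ _) (hd _ ha') (hd _ hb') (hd _ hc') hab hbc)

theorem Conn.induce {C : Finset V} (h : Conn G C) :
    Conn (G.induce (C : Set V)) Finset.univ := by
  refine ⟨?_, ?_⟩
  · obtain ⟨u, hu⟩ := h.1
    exact ⟨⟨u, hu⟩, Finset.mem_univ _⟩
  · intro T _ hne hT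
    have hsub : C ⊆ T.map (Function.Embedding.subtype _) := by
      refine h.subset_of_closed ?_ ?_
      · obtain ⟨t, ht⟩ := hne
        exact ⟨t.1, t.2, Finset.mem_map.2 ⟨t, ht, rfl⟩⟩
      · intro u _ huT w hw huw
        obtain ⟨t, ht, rfl⟩ := Finset.mem_map.1 huT
        exact Finset.mem_map.2 ⟨⟨w, hw⟩, hT t ht ⟨w, hw⟩ (Finset.mem_univ _) huw, rfl⟩
    ext u
    simp only [Finset.mem_univ, iff_true]
    obtain ⟨t, ht, htu⟩ := Finset.mem_map.1 (hsub u.2)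
    rwa [← Subtype.ext htu]

theorem NoC6.induce (h : NoC6 G) (C : Set V) : NoC6 (G.induce C) := by
  intro a b c d e f h1 h2 h3 h4 h5 h6 n1 n2 n3 n4 n5 n6 n7 n8 n9
  have hn : ∀ {a b : C}, a ≠ b → a.1 ≠ b.1 := fun h h' => h (Subtype.ext h')
  exact h a b c d e f h1 h2 h3 h4 h5 h6 (hn n1) (hn n2) (hn n3) (hn n4) (hn n5) (hn n6) (hn n7)
    (hn n8) (hn n9)

end

section
open Classical

universe u

theorem quarter_of_conn : ∀ (n : ℕ) (V : Type u) [Fintype V] (G : SimpleGraph V),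
    Fintype.card V = n → Conn G Finset.univ → NoC6 G → ¬ IsSGraph G →
      Quarter G Finset.univ (Fintype.card V) := by
  intro n
  induction n using Nat.strong_induction_on with
  | _ n ih =>
    intro V _ G hn hc h6 hS
    by_contra hq
    have hG : Minimal G := by
      refine ⟨?_, hc, h6, hq⟩
      intro C hCne hC hCS
      have hcard : Fintype.card (C : Set V) = C.card := by simp
      have hlt : C.card < n := by
        rw [← hn, ← Finset.card_univ]
        exact Finset.card_lt_card (Finset.ssubset_univ_iff.2 hCne)
      have := ih _ (hcard ▸ hlt) (C : Set V) (G.induce (C : Set V)) rfl hC.induce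
        (h6.induce _) hCS
      rw [hcard] at this
      exact this.of_induce
    exact hq (quarter_of_card_nb_le_two hc hG.card_nb_le_two h6 hS)

end

section

variable {V : Type*} {G : SimpleGraph V}

theorem conn_of_connected [Fintype V] (h : G.Connected) : Conn G Finset.univ := by
  refine ⟨?_, ?_⟩
  · obtain ⟨v⟩ := h.nonempty
    exact ⟨v, Finset.mem_univ v⟩
  · intro T _ hne hT
    obtain ⟨t, ht⟩ := hne
    have key : ∀ u w, G.Walk u w → u ∈ T → w ∈ T := by
      intro u w p
      induction p with
      | nil => exact id
      | cons hadj _ ih => exact fun hu => ih (hT _ hu _ (Finset.mem_univ _) hadj)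
    ext w
    simp only [Finset.mem_univ, iff_true]
    obtain ⟨p⟩ := h.preconnected t w
    exact key _ _ p ht

theorem noC6_of_free (h : (SimpleGraph.cycleGraph 6).Free G) : NoC6 G := by
  intro a b c d e f h1 h2 h3 h4 h5 h6 n1 n2 n3 n4 n5 n6 n7 n8 n9
  have h1' := h1.ne
  have h2' := h2.ne
  have h3' := h3.ne
  have h4' := h4.ne
  have h5' := h5.ne
  have h6' := h6.ne
  refine h ⟨⟨⟨![a, b, c, d, e, f], ?_⟩, ?_⟩⟩
  · intro i j hij
    rw [SimpleGraph.cycleGraph_adj] at hij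
    have : (i, j) ∈ [((0 : Fin 6), (1 : Fin 6)), (1, 2), (2, 3), (3, 4), (4, 5), (5, 0),
        (1, 0), (2, 1), (3, 2), (4, 3), (5, 4), (0, 5)] := by
      revert i j; decide
    simp only [List.mem_cons, Prod.mk.injEq, List.not_mem_nil, or_false] at this
    rcases this with ⟨rfl, rfl⟩ | ⟨rfl, rfl⟩ | ⟨rfl, rfl⟩ | ⟨rfl, rfl⟩ | ⟨rfl, rfl⟩ | ⟨rfl, rfl⟩ |
      ⟨rfl, rfl⟩ | ⟨rfl, rfl⟩ | ⟨rfl, rfl⟩ | ⟨rfl, rfl⟩ | ⟨rfl, rfl⟩ | ⟨rfl, rfl⟩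
    exacts [h1, h2, h3, h4, h5, h6, h1.symm, h2.symm, h3.symm, h4.symm, h5.symm, h6.symm]
  · have hnd : [a, b, c, d, e, f].Nodup := by
      simp only [List.nodup_cons, List.mem_cons, List.not_mem_nil, or_false, not_or,
        List.nodup_nil, and_true, not_false_eq_true]
      exact ⟨⟨h1', n1, n2, n3, h6'.symm⟩, ⟨h2', n4, n5, n6⟩, ⟨h3', n7, n8⟩, ⟨h4', n9⟩, h5'⟩
    have : ![a, b, c, d, e, f] = fun i : Fin 6 => [a, b, c, d, e, f].get i := by
      ext i
      fin_cases i <;> rfl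
    intro i j hij
    exact List.nodup_iff_injective_get.1 hnd
      ((congrFun this i).symm.trans (hij.trans (congrFun this j)))

theorem isIsolating_one_iff [Fintype V] {D : Finset V} :
    IsIsolating G 1 D ↔ Iso G Finset.univ D := by
  classical
  have hmem : ∀ u, u ∈ (closedNbhd G D)ᶜ ↔ ¬ Dom G D u := fun u => Iff.rfl
  unfold IsIsolating
  constructor
  · intro h a b c _ _ _ ha hb hc hab hbc
    have hdeg := (SimpleGraph.degree_le_maxDegree _
      (⟨b, (hmem b).2 hb⟩ : ((closedNbhd G D)ᶜ : Set V))).trans h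
    rw [← SimpleGraph.card_neighborFinset_eq_degree, Finset.card_le_one] at hdeg
    exact congrArg Subtype.val (hdeg ⟨a, (hmem a).2 ha⟩
      ((SimpleGraph.mem_neighborFinset _ _ _).2 hab.symm) ⟨c, (hmem c).2 hc⟩
      ((SimpleGraph.mem_neighborFinset _ _ _).2 hbc))
  · intro h
    apply SimpleGraph.maxDegree_le_of_forall_degree_le
    rintro ⟨b, hb⟩
    rw [← SimpleGraph.card_neighborFinset_eq_degree, Finset.card_le_one]
    rintro ⟨a, ha⟩ haN ⟨c, hc⟩ hcN
    rw [SimpleGraph.mem_neighborFinset] at haN hcN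
    exact Subtype.ext (h a b c (Finset.mem_univ _) (Finset.mem_univ _) (Finset.mem_univ _)
      ((hmem a).1 ha) ((hmem b).1 hb) ((hmem c).1 hc) haN.symm hcN)

theorem four_mul_isolationNumber_le [Fintype V] (hc : G.Connected)
    (h6 : (SimpleGraph.cycleGraph 6).Free G) (hS : ¬ IsSGraph G) :
    4 * isolationNumber 1 G ≤ Fintype.card V := by
  obtain ⟨D, hD, hi⟩ := quarter_of_conn _ V G rfl (conn_of_connected hc) (noC6_of_free h6) hS
  have : isolationNumber 1 G ≤ D.card := Nat.sInf_le ⟨D, isIsolating_one_iff.2 hi, rfl⟩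
  omega

end

section

variable {U : Type*} {H : SimpleGraph U}

theorem IsSGraph.card [Fintype U] (h : IsSGraph H) :
    Fintype.card U = 3 ∨ Fintype.card U = 7 ∨ Fintype.card U = 11 := by
  rcases h with ⟨⟨e⟩⟩ | ⟨⟨e⟩⟩ | ⟨⟨e⟩⟩ | ⟨⟨e⟩⟩ <;> have := Fintype.card_congr e.toEquiv <;>
    simp only [Fintype.card_fin] at this <;> omega

theorem IsSGraph.connected (h : IsSGraph H) : H.Connected := by
  rcases h with ⟨⟨e⟩⟩ | ⟨⟨e⟩⟩ | ⟨⟨e⟩⟩ | ⟨⟨e⟩⟩ <;> rw [e.connected_iff]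
  · exact SimpleGraph.pathGraph_connected 2
  · exact SimpleGraph.cycleGraph_connected
  · exact SimpleGraph.cycleGraph_connected
  · exact SimpleGraph.cycleGraph_connected

theorem cycleGraph_six_free {n : ℕ} (hn : (1 + 1 + 1 + 1 + 1 + 1 : Fin (n + 2)) ≠ 0) :
    (SimpleGraph.cycleGraph 6).Free (SimpleGraph.cycleGraph (n + 2)) := by
  rintro ⟨g⟩
  have hadj : ∀ i : Fin 6, g (i + 1) = g i + 1 ∨ g (i + 1) = g i - 1 := by
    intro i
    have h : (SimpleGraph.cycleGraph 6).Adj i (i + 1) := by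
      rw [SimpleGraph.cycleGraph_adj]; simp
    have h' := g.toHom.map_adj h
    rw [SimpleGraph.cycleGraph_adj] at h'
    change g i - g (i + 1) = 1 ∨ g (i + 1) - g i = 1 at h'
    rcases h' with h' | h'
    · right
      rw [← h']; abel
    · left
      rw [← h']; abel
  have hne : ∀ i : Fin 6, g (i + 1 + 1) ≠ g i := by
    intro i h
    exact (by decide : ∀ i : Fin 6, i + 1 + 1 ≠ i) i (g.injective h)
  rcases hadj 0 with h | h
  · have step : ∀ i : Fin 6, g (i + 1) = g i + 1 → g (i + 1 + 1) = g (i + 1) + 1 := by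
      intro i hi
      refine (hadj (i + 1)).resolve_right fun h => hne i ?_
      rw [h, hi]; abel
    have h1 := step 0 h
    have h2 := step _ h1
    have h3 := step _ h2
    have h4 := step _ h3
    have h5 := step _ h4
    rw [h4, h3, h2, h1, h] at h5
    have h6 : g 0 = g 0 + (1 + 1 + 1 + 1 + 1 + 1) := by
      refine Eq.trans ?_ (h5.trans ?_)
      · rfl
      · abel
    exact hn (left_eq_add.1 h6)
  · have step : ∀ i : Fin 6, g (i + 1) = g i - 1 → g (i + 1 + 1) = g (i + 1) - 1 := by
      intro i hi
      refine (hadj (i + 1)).resolve_left fun h => hne i ?_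
      rw [h, hi]; abel
    have h1 := step 0 h
    have h2 := step _ h1
    have h3 := step _ h2
    have h4 := step _ h3
    have h5 := step _ h4
    rw [h4, h3, h2, h1, h] at h5
    have h6 : g 0 = g 0 - (1 + 1 + 1 + 1 + 1 + 1) := by
      refine Eq.trans ?_ (h5.trans ?_)
      · rfl
      · abel
    exact hn (sub_eq_self.1 h6.symm)

theorem IsSGraph.free (h : IsSGraph H) : (SimpleGraph.cycleGraph 6).Free H := by
  have three : ∀ K : SimpleGraph (Fin 3), (SimpleGraph.cycleGraph 6).Free K := by
    rintro K ⟨g⟩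
    have := Fintype.card_le_of_injective g g.injective
    simp at this
  rcases h with ⟨⟨e⟩⟩ | ⟨⟨e⟩⟩ | ⟨⟨e⟩⟩ | ⟨⟨e⟩⟩ <;> rw [SimpleGraph.free_congr_right e]
  · exact three _
  · exact three _
  · exact cycleGraph_six_free (n := 5) (by decide)
  · exact cycleGraph_six_free (n := 9) (by decide)

theorem card_le_five_mul_of_iso [Fintype U] {n : ℕ} (hn : (1 + 1 : Fin (n + 2)) ≠ 0)
    (e : H ≃g SimpleGraph.cycleGraph (n + 2)) {D : Finset U} (hD : Iso H Finset.univ D) :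
    n + 2 ≤ 5 * D.card := by
  have hdom : ∀ j, Dom H D (e.symm j) → ∃ d ∈ D, j = e d ∨ e d = j + 1 ∨ e d = j - 1 := by
    rintro j ⟨d, hd, h⟩
    refine ⟨d, hd, ?_⟩
    rcases h with h | h
    · left
      rw [← h]; simp
    · rw [← e.map_adj_iff, SimpleGraph.cycleGraph_adj] at h
      simp only [RelIso.apply_symm_apply] at h
      rcases h with h | h
      · right; left
        rw [← h]; abel
      · right; right
        rw [← h]; abel
  have hadj : ∀ j, H.Adj (e.symm j) (e.symm (j + 1)) := by
    intro j
    rw [e.symm.map_adj_iff, SimpleGraph.cycleGraph_adj]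
    simp
  have hcover : (Finset.univ : Finset (Fin (n + 2))) ⊆
      D.biUnion fun d => {e d + 1, e d, e d - 1, e d - 1 - 1, e d - 1 - 1 - 1} := by
    intro i _
    have h : ∃ j, (j = i ∨ j = i + 1 ∨ j = i + 1 + 1) ∧ Dom H D (e.symm j) := by
      by_contra! hc
      have := hD (e.symm i) (e.symm (i + 1)) (e.symm (i + 1 + 1)) (Finset.mem_univ _)
        (Finset.mem_univ _) (Finset.mem_univ _) (hc _ (by simp)) (hc _ (by simp)) (hc _ (by simp))
        (hadj _) (hadj _)
      have := e.symm.injective this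
      rw [add_assoc] at this
      exact hn (left_eq_add.1 this)
    obtain ⟨j, hj, hjd⟩ := h
    obtain ⟨d, hd, h⟩ := hdom j hjd
    refine Finset.mem_biUnion.2 ⟨d, hd, ?_⟩
    simp only [Finset.mem_insert, Finset.mem_singleton]
    rcases hj with rfl | rfl | rfl <;> rcases h with h | h | h
    · simp [h]
    · right; right; left; rw [h]; abel
    · left; rw [h]; abel
    · right; right; left; rw [← h]; abel
    · right; right; right; left; rw [h]; abel
    · right; left; rw [h]; abel
    · right; right; right; left; rw [← h]; abel
    · right; right; right; right; rw [h]; abel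
    · right; right; left; rw [h]; abel
  have h1 := (Finset.card_le_card hcover).trans
    (Finset.card_biUnion_le_card_mul _ _ 5 fun d _ => Finset.card_le_five)
  rw [Finset.card_univ, Fintype.card_fin] at h1
  omega

theorem IsSGraph.card_le_of_iso [Fintype U] (h : IsSGraph H) {D : Finset U}
    (hD : Iso H Finset.univ D) : Fintype.card U + 1 ≤ 4 * D.card := by
  rcases h with ⟨⟨e⟩⟩ | ⟨⟨e⟩⟩ | ⟨⟨e⟩⟩ | ⟨⟨e⟩⟩
  all_goals have hc := Fintype.card_congr e.toEquiv
  all_goals rw [Fintype.card_fin] at hc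
  · have : D.Nonempty := by
      by_contra hne
      rw [Finset.not_nonempty_iff_eq_empty] at hne
      subst hne
      have hn : ∀ u, ¬ Dom H ∅ u := by rintro u ⟨d, hd, -⟩; simp at hd
      have := hD (e.symm 0) (e.symm 1) (e.symm 2) (Finset.mem_univ _) (Finset.mem_univ _)
        (Finset.mem_univ _) (hn _) (hn _) (hn _)
        (by rw [e.symm.map_adj_iff, SimpleGraph.pathGraph_adj]; simp)
        (by rw [e.symm.map_adj_iff, SimpleGraph.pathGraph_adj]; simp)
      have := e.symm.injective this
      simp at this
    have := Finset.card_pos.2 this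
    omega
  · have := card_le_five_mul_of_iso (n := 1) (by decide) e hD
    omega
  · have := card_le_five_mul_of_iso (n := 5) (by decide) e hD
    omega
  · have := card_le_five_mul_of_iso (n := 9) (by decide) e hD
    omega

end

section

variable {W : Type*} {U : W → Type*} {F : SimpleGraph W} {H : ∀ w, SimpleGraph (U w)}
  {a : ∀ w, U w}

theorem attach_adj_inr {w : W} {x y : U w} :
    (attach F H a).Adj (.inr ⟨w, x⟩) (.inr ⟨w, y⟩) ↔ (H w).Adj x y := by
  constructor
  · rintro ⟨w', x', y', hx, hy, h⟩
    obtain ⟨rfl, hx⟩ := Sigma.mk.inj_iff.1 hx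
    obtain rfl := eq_of_heq hx
    obtain rfl := eq_of_heq (Sigma.mk.inj_iff.1 hy).2
    exact h
  · exact fun h => ⟨w, x, y, rfl, rfl, h⟩

theorem connected_attach (hF : F.Connected) (hH : ∀ w, (H w).Connected) :
    (attach F H a).Connected := by
  obtain ⟨w₀⟩ := hF.nonempty
  let i : F →g attach F H a := ⟨Sum.inl, fun h => h⟩
  have hl : ∀ w, (attach F H a).Reachable (.inl w₀) (.inl w) := fun w =>
    (hF.preconnected w₀ w).map i
  rw [SimpleGraph.connected_iff_exists_forall_reachable]
  refine ⟨.inl w₀, ?_⟩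
  rintro (w | ⟨w, x⟩)
  · exact hl w
  · let j : H w →g attach F H a := ⟨fun x => Sum.inr ⟨w, x⟩, fun h => attach_adj_inr.2 h⟩
    have h1 : (attach F H a).Adj (.inl w) (.inr ⟨w, a w⟩) := rfl
    exact ((hl w).trans h1.reachable).trans (((hH w).preconnected (a w) x).map j)

theorem free_attach (hF : (SimpleGraph.cycleGraph 6).Free F)
    (hH : ∀ w, (SimpleGraph.cycleGraph 6).Free (H w)) :
    (SimpleGraph.cycleGraph 6).Free (attach F H a) := by
  rintro ⟨c⟩
  have hadj : ∀ i : Fin 6, (attach F H a).Adj (c i) (c (i + 1)) := by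
    intro i
    refine c.toHom.map_adj ?_
    rw [SimpleGraph.cycleGraph_adj]; simp
  have hinr : ∀ i w, (∃ x, c i = .inr ⟨w, x⟩) → (∃ p, c (i + 1) = .inr p) →
      ∃ x, c (i + 1) = .inr ⟨w, x⟩ := by
    rintro i w ⟨x, hx⟩ ⟨p, hp⟩
    have h := hadj i
    rw [hx, hp] at h
    obtain ⟨w', x', y', hx', rfl, -⟩ := h
    obtain rfl := (Sigma.mk.inj_iff.1 hx').1
    exact ⟨y', hp⟩
  have hsix : ∀ i : Fin 6, i + 1 + 1 ≠ i ∧ i + 1 + 1 + 1 ≠ i ∧ i + 1 + 1 + 1 + 1 ≠ i ∧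
      i + 1 + 1 + 1 + 1 + 1 ≠ i ∧ i + 1 + 1 + 1 + 1 + 1 + 1 = i ∧
      i + 1 + 1 + 1 + 1 + 1 ≠ i + 1 := by decide
  have hcover : ∀ i j : Fin 6, j = i ∨ j = i + 1 ∨ j = i + 1 + 1 ∨ j = i + 1 + 1 + 1 ∨
      j = i + 1 + 1 + 1 + 1 ∨ j = i + 1 + 1 + 1 + 1 + 1 := by decide
  have hinl : ∀ i : Fin 6, (∃ v, c i = .inl v) → ∃ v, c (i + 1) = .inl v := by
    rintro i ⟨v, hv⟩
    rcases hc : c (i + 1) with u | p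
    · exact ⟨u, rfl⟩
    exfalso
    have h0 := hadj i
    rw [hv, hc] at h0
    have hp : p = ⟨v, a v⟩ := h0
    have step : ∀ j : Fin 6, j + 1 ≠ i → (∃ x, c j = .inr ⟨v, x⟩) → ∃ x, c (j + 1) = .inr ⟨v, x⟩ := by
      intro j hj hx
      rcases hcj : c (j + 1) with u | q
      · exfalso
        obtain ⟨x, hx⟩ := hx
        have h := hadj j
        rw [hx, hcj] at h
        have h' : (⟨v, x⟩ : Σ w, U w) = ⟨u, a u⟩ := h
        obtain rfl := (Sigma.mk.inj_iff.1 h').1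
        exact hj (c.injective (hcj.trans hv.symm))
      · obtain ⟨x, hx'⟩ := hinr j v hx ⟨q, hcj⟩
        exact ⟨x, hcj ▸ hx'⟩
    have h1 : ∃ x, c (i + 1) = .inr ⟨v, x⟩ := ⟨a v, by rw [hc, hp]⟩
    obtain ⟨n2, n3, n4, n5, n6, n7⟩ := hsix i
    obtain ⟨x, h5⟩ := step _ n5 (step _ n4 (step _ n3 (step _ n2 h1)))
    have h := hadj (i + 1 + 1 + 1 + 1 + 1)
    rw [n6, h5, hv] at h
    have h' : (⟨v, x⟩ : Σ w, U w) = ⟨v, a v⟩ := h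
    rw [h', ← hp, ← hc] at h5
    exact n7 (c.injective h5)
  have hall : ∀ i v, c i = .inl v → ∀ j, ∃ v, c j = .inl v := by
    intro i v hv
    have h1 := hinl i ⟨v, hv⟩
    have h2 := hinl _ h1
    have h3 := hinl _ h2
    have h4 := hinl _ h3
    have h5 := hinl _ h4
    intro j
    rcases hcover i j with rfl | rfl | rfl | rfl | rfl | rfl
    exacts [⟨v, hv⟩, h1, h2, h3, h4, h5]
  rcases h0 : c 0 with v | ⟨w, x⟩
  · choose g hg using hall 0 v h0
    refine hF ⟨⟨⟨g, ?_⟩, ?_⟩⟩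
    · intro i j hij
      have := c.toHom.map_adj hij
      change (attach F H a).Adj (c i) (c j) at this
      rwa [hg i, hg j] at this
    · intro i j hij
      exact c.injective ((hg i).trans ((congrArg Sum.inl hij).trans (hg j).symm))
  · have hr : ∀ i, ∃ p, c i = .inr p := by
      intro i
      rcases hc : c i with v | p
      · obtain ⟨v', hv'⟩ := hall i v hc 0
        rw [h0] at hv'
        cases hv'
      · exact ⟨p, rfl⟩
    have h1 := hinr 0 w ⟨x, h0⟩ (hr _)
    have h2 := hinr _ w h1 (hr _)
    have h3 := hinr _ w h2 (hr _)
    have h4 := hinr _ w h3 (hr _)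
    have h5 := hinr _ w h4 (hr _)
    have hw : ∀ j, ∃ x, c j = .inr ⟨w, x⟩ := by
      intro j
      rcases hcover 0 j with rfl | rfl | rfl | rfl | rfl | rfl
      exacts [⟨x, h0⟩, h1, h2, h3, h4, h5]
    choose g hg using hw
    refine hH w ⟨⟨⟨g, ?_⟩, ?_⟩⟩
    · intro i j hij
      have := c.toHom.map_adj hij
      change (attach F H a).Adj (c i) (c j) at this
      rw [hg i, hg j] at this
      exact attach_adj_inr.1 this
    · intro i j hij
      exact c.injective ((hg i).trans
        ((congrArg (fun x => Sum.inr (Sigma.mk w x)) hij).trans (hg j).symm))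

variable [Fintype W] [∀ w, Fintype (U w)]

theorem card_attach : Fintype.card (W ⊕ Σ w, U w) = ∑ w, (Fintype.card (U w) + 1) := by
  rw [Fintype.card_sum, Fintype.card_sigma, Finset.sum_add_distrib, add_comm]
  simp

theorem not_isSGraph_attach (hH : ∀ w, IsSGraph (H w)) : ¬ IsSGraph (attach F H a) := by
  intro h
  have h4 : 4 ∣ Fintype.card (W ⊕ Σ w, U w) := by
    rw [card_attach]
    refine Finset.dvd_sum fun w _ => ?_
    rcases (hH w).card with h | h | h <;> rw [h] <;> norm_num
  rcases h.card with h | h | h <;> rw [h] at h4 <;> norm_num at h4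

theorem card_attach_le_of_iso (hH : ∀ w, IsSGraph (H w)) {D : Finset (W ⊕ Σ w, U w)}
    (hD : Iso (attach F H a) Finset.univ D) : Fintype.card (W ⊕ Σ w, U w) ≤ 4 * D.card := by
  classical
  let π : (W ⊕ Σ w, U w) → W := Sum.elim id Sigma.fst
  have hfib : D.card = ∑ w, (D.filter fun d => π d = w).card :=
    Finset.card_eq_sum_card_fiberwise fun _ _ => Finset.mem_coe.2 (Finset.mem_univ _)
  rw [card_attach, hfib, Finset.mul_sum]
  refine Finset.sum_le_sum fun w _ => ?_
  let S : Finset (U w) := Finset.univ.filter fun x => .inr ⟨w, x⟩ ∈ D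
  let T : Finset W := if .inl w ∈ D then {w} else ∅
  have hT : ∀ v, v ∈ T ↔ v = w ∧ .inl w ∈ D := by
    intro v
    by_cases h : (Sum.inl w : W ⊕ Σ w, U w) ∈ D <;> simp [T, h]
  have hiso : Iso (H w) Finset.univ (S ∪ T.image fun _ => a w) := by
    have hd : ∀ x, ¬ Dom (H w) (S ∪ T.image fun _ => a w) x →
        ¬ Dom (attach F H a) D (.inr ⟨w, x⟩) := by
      rintro x hx ⟨d, hd, h⟩
      apply hx
      rcases d with v | ⟨v, y⟩
      · rcases h with h | h
        · cases h
        · have h' : (⟨w, x⟩ : Σ w, U w) = ⟨v, a v⟩ := h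
          obtain ⟨rfl, hx'⟩ := Sigma.mk.inj_iff.1 h'
          obtain rfl := eq_of_heq hx'
          refine ⟨a w, Finset.mem_union_right _ ?_, Or.inl rfl⟩
          exact Finset.mem_image.2 ⟨w, (hT w).2 ⟨rfl, hd⟩, rfl⟩
      · have hvw : v = w := by
          rcases h with h | ⟨_, _, _, h1, h2, -⟩
          · exact (Sigma.mk.inj_iff.1 (Sum.inr.inj h)).1.symm
          · exact (Sigma.mk.inj_iff.1 h1).1.trans (Sigma.mk.inj_iff.1 h2).1.symm
        subst hvw
        refine ⟨y, Finset.mem_union_left _ (by simpa [S] using hd), ?_⟩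
        refine h.imp ?_ attach_adj_inr.1
        intro h
        exact eq_of_heq (Sigma.mk.inj_iff.1 (Sum.inr.inj h)).2
    intro x y z _ _ _ hx hy hz hxy hyz
    have := hD _ _ _ (Finset.mem_univ _) (Finset.mem_univ _) (Finset.mem_univ _) (hd x hx)
      (hd y hy) (hd z hz) (attach_adj_inr.2 hxy) (attach_adj_inr.2 hyz)
    exact eq_of_heq (Sigma.mk.inj_iff.1 (Sum.inr.inj this)).2
  refine ((hH w).card_le_of_iso hiso).trans (Nat.mul_le_mul_left 4 ?_)
  have hS : S.card = (S.image fun x => (Sum.inr ⟨w, x⟩ : W ⊕ Σ w, U w)).card := by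
    refine (Finset.card_image_of_injective _ fun x y h => ?_).symm
    exact eq_of_heq (Sigma.mk.inj_iff.1 (Sum.inr.inj h)).2
  have hT' : T.card = (T.image fun v => (Sum.inl v : W ⊕ Σ w, U w)).card :=
    (Finset.card_image_of_injective _ Sum.inl_injective).symm
  calc (S ∪ T.image fun _ => a w).card ≤ S.card + T.card :=
        (Finset.card_union_le _ _).trans (Nat.add_le_add_left Finset.card_image_le _)
    _ = ((S.image fun x => (Sum.inr ⟨w, x⟩ : W ⊕ Σ w, U w)) ∪
          T.image fun v => (Sum.inl v : W ⊕ Σ w, U w)).card := by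
        rw [hS, hT', Finset.card_union_of_disjoint]
        rw [Finset.disjoint_left]
        intro d hd hd'
        obtain ⟨x, -, rfl⟩ := Finset.mem_image.1 hd
        obtain ⟨v, -, h⟩ := Finset.mem_image.1 hd'
        cases h
    _ ≤ (D.filter fun d => π d = w).card := by
        refine Finset.card_le_card (Finset.union_subset ?_ ?_)
        · intro d hd
          obtain ⟨x, hx, rfl⟩ := Finset.mem_image.1 hd
          exact Finset.mem_filter.2 ⟨(Finset.mem_filter.1 hx).2, rfl⟩
        · intro d hd
          obtain ⟨v, hv, rfl⟩ := Finset.mem_image.1 hd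
          obtain ⟨rfl, hv⟩ := (hT v).1 hv
          exact Finset.mem_filter.2 ⟨hv, rfl⟩

end
end IsolationPaper

theorem theorem1p6 :
    (∀ (V : Type*) [Fintype V] (G : SimpleGraph V),
      G.Connected → (SimpleGraph.cycleGraph 6).Free G → ¬ IsolationPaper.IsSGraph G →
        (IsolationPaper.isolationNumber 1 G : ℚ) ≤ (Fintype.card V : ℚ) / 4) ∧
    (∀ (W : Type*) [Fintype W] (U : W → Type*) [∀ w, Fintype (U w)]
      (F : SimpleGraph W) (H : ∀ w, SimpleGraph (U w)) (a : ∀ w, U w),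
      F.Connected → (SimpleGraph.cycleGraph 6).Free F → (∀ w, IsolationPaper.IsSGraph (H w)) →
        (IsolationPaper.attach F H a).Connected ∧
        (SimpleGraph.cycleGraph 6).Free (IsolationPaper.attach F H a) ∧
        ¬ IsolationPaper.IsSGraph (IsolationPaper.attach F H a) ∧
        (IsolationPaper.isolationNumber 1 (IsolationPaper.attach F H a) : ℚ) =
          (Fintype.card (W ⊕ Σ w, U w) : ℚ) / 4) := by
  refine ⟨?_, ?_⟩
  · intro V _ G hc h6 hS
    have := IsolationPaper.four_mul_isolationNumber_le hc h6 hS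
    rw [le_div_iff₀ (by norm_num), mul_comm]
    exact_mod_cast this
  · intro W _ U _ F H a hF h6 hH
    have h1 := IsolationPaper.connected_attach (a := a) hF fun w => (hH w).connected
    have h2 := IsolationPaper.free_attach (a := a) h6 fun w => (hH w).free
    have h3 := IsolationPaper.not_isSGraph_attach (F := F) (a := a) hH
    refine ⟨h1, h2, h3, ?_⟩
    have hle := IsolationPaper.four_mul_isolationNumber_le h1 h2 h3
    obtain ⟨D, hD, hcard⟩ :=
      IsolationPaper.exists_isIsolating_card_eq 1 (IsolationPaper.attach F H a)
    have hge := IsolationPaper.card_attach_le_of_iso hH (IsolationPaper.isIsolating_one_iff.1 hD)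
    rw [hcard] at hge
    rw [eq_div_iff (by norm_num), mul_comm]
    exact_mod_cast le_antisymm hle hge
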